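/- Consider a stable two-class $M|G|1$ queue with preemptive-resume priorities: Poisson arrivals of rate $\lambda>0$, i.i.d. service requirements $S\ge 0$ with mean $1/\mu\in(0,\infty)$ and finite second moment $E[S^2]=K/\mu^2$, and load $\rho=\lambda/\mu<1$. Each arriving customer joins the premium class with probability $\phi\in[0,1]$, independently of everything else, and the ordinary class otherwise; premium work preempts ordinary work, interrupted services are resumed, and service is first come first served within a class. Let $E[W_p]$ and $E[W_o]$ be the steady-state expected waiting times (time in system not spent in service) of a customer who joins the premium, respectively the ordinary, class when the population plays $\phi$. These are finite limits, as $n\to\infty$, of the expected waiting times of the $n$-th customer of the queue started empty, and $$C(\phi):=E[W_o]-E[W_p]=\frac{K\rho+(2-K)\phi\rho(1-\rho)}{2\mu(1-\rho)(1-\phi\rho)} .$$ Joining the premium class costs a fee $C\in\mathbb R$. A customer who joins with probability $\psi$ while the population plays $\phi$ has expected cost $J(\psi,\phi)=\psi(E[W_p]+C)+(1-\psi)E[W_o]$. A strategy $\psi$ is a best response to $\phi$ if it minimizes $J(\cdot,\phi)$ on $[0,1]$; $\phi$ is an equilibrium if it is a best response to itself, and a mixed equilibrium if moreover $0<\phi<1$.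 A unique mixed equilibrium is a mixed equilibrium which is the only equilibrium, pure or mixed. An equilibrium $\phi$ is an evolutionarily stable strategy (ESS) if no initially rare strategy can invade it, i.e. for each $\psi\neq\phi$ there is $\varepsilon_0>0$ such that $J(\phi,(1-\varepsilon)\phi+\varepsilon\psi)<J(\psi,(1-\varepsilon)\phi+\varepsilon\psi)$ for all $\varepsilon\in(0,1]$ with $\varepsilon<\varepsilon_0$, and if no other equilibrium is a best response to $\phi$. Then there is a fee $C$ for which a unique mixed equilibrium exists if and only if $$K>2\quad\text{and}\quad \rho<\frac{K-2}{2K-2};$$ more precisely, for each fee $C$, a unique mixed equilibrium exists if and only if these two conditions hold and $C(1)<C<C(0)$. The condition $K>2$ holds if and only if the coefficient of variation of the service requirement exceeds $1$. Every unique mixed equilibrium is an ESS. -/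

import Mathlib

open MeasureTheory ProbabilityTheory Filter Topology
open scoped ENNReal unitInterval

noncomputable section

/-- The primitives of a stable `M|G|1` queue: Poisson arrivals of rate `lam`, i.i.d. service
requirements with law `service` (non-negative, positive mean, finite second moment), and traffic
load less than one. -/
structure MG1Queue where
  /-- mean arrival rate -/
  lam : ℝ
  /-- law of a service requirement -/
  service : Measure ℝ
  lam_pos : 0 < lam
  isProb : IsProbabilityMeasure service
  service_nonneg : ∀ᵐ s ∂service, 0 ≤ s
  service_sq_integrable : Integrable (fun s : ℝ => s ^ 2) service
  service_mean_pos : 0 < ∫ s, s ∂service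
  stable : lam * ∫ s, s ∂service < 1

/-- The data of one customer: whether the customer joins the premium class (`true`) or the ordinary
class (`false`), the service requirement, and the time from this arrival to the next one. -/
abbrev Customer : Type := Bool × ℝ × ℝ

namespace Customer

def premium (c : Customer) : Bool := c.1

def req (c : Customer) : ℝ := c.2.1

def gap (c : Customer) : ℝ := c.2.2

/-- Premium work brought by the customer. -/
def premiumReq (c : Customer) : ℝ := if c.premium then c.req else 0

/-- Ordinary work brought by the customer. -/
def ordinaryReq (c : Customer) : ℝ := if c.premium then 0 else c.req

end Customer

namespace MG1Queue

/-! ### Sample paths of the two-class preemptive-resume queue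

A sample path is a sequence `ω : ℕ → Customer`. Customer `0` finds an empty system. -/

/-- Unfinished (premium, ordinary) work found by the `n`-th arriving customer. The server works at
unit speed on premium work as long as there is any, and on ordinary work otherwise; an interrupted
service is resumed where it stopped, so that no work is lost. -/
def workFound (ω : ℕ → Customer) : ℕ → ℝ × ℝ
  | 0 => (0, 0)
  | n + 1 =>
    let x : ℝ := (workFound ω n).1 + (ω n).premiumReq
    let y : ℝ := (workFound ω n).2 + (ω n).ordinaryReq
    let a : ℝ := (ω n).gap
    (max (x - a) 0, max (y - max (a - x) 0) 0)

/-- Time between the arrivals of customers `n` and `n + k`. -/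
def elapsed (ω : ℕ → Customer) (n k : ℕ) : ℝ :=
  ∑ j ∈ Finset.range k, (ω (n + j)).gap

/-- Premium work brought by later customers during the first `t` time units after the arrival of
customer `n`. -/
def laterPremiumWork (ω : ℕ → Customer) (n : ℕ) (t : ℝ≥0∞) : ℝ≥0∞ :=
  ∑' k : ℕ, if ENNReal.ofReal (elapsed ω n (k + 1)) < t
    then ENNReal.ofReal (ω (n + (k + 1))).premiumReq else 0

/-- Waiting time (time in system not spent in service) of the `n`-th customer if this customer
joins the premium class: the premium work found must be served first (first come first served
within a class), ordinary work is preempted. -/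
def premiumWait (ω : ℕ → Customer) (n : ℕ) : ℝ≥0∞ :=
  ENNReal.ofReal (workFound ω n).1

/-- Time in system of the `n`-th customer if this customer joins the ordinary class: the first time
by which the server has been able to complete all work found, the customer's own requirement,
and all premium work that has arrived meanwhile. -/
def ordinarySojourn (ω : ℕ → Customer) (n : ℕ) : ℝ≥0∞ :=
  sInf {t : ℝ≥0∞ |
    ENNReal.ofReal ((workFound ω n).1 + (workFound ω n).2 + (ω n).req)
      + laterPremiumWork ω n t ≤ t}

/-- Waiting time (time in system not spent in service) of the `n`-th customer if this customer
joins the ordinary class. -/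
def ordinaryWait (ω : ℕ → Customer) (n : ℕ) : ℝ≥0∞ :=
  ordinarySojourn ω n - ENNReal.ofReal (ω n).req

variable (Q : MG1Queue)

/-- Mean service rate `μ`: the mean service requirement is `1 / μ`. -/
def mu : ℝ := (∫ s, s ∂Q.service)⁻¹

/-- Traffic load `ρ = λ / μ`. -/
def rho : ℝ := Q.lam / Q.mu

/-- Variance parameter `K`: the second moment of the service requirement is `K / μ ^ 2`. -/
def K : ℝ := Q.mu ^ 2 * ∫ s, s ^ 2 ∂Q.service

/-- The law of the sample path when every customer joins the premium class with probability `φ`: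
customers are i.i.d., with independent class (Bernoulli), requirement, and exponential gap. -/
def law (φ : I) : Measure (ℕ → Customer) :=
  Measure.infinitePi fun _ : ℕ =>
    (bernoulliMeasure true false φ).prod (Q.service.prod (expMeasure Q.lam))

/-- Expected waiting time of the `n`-th customer if this customer joins the premium class. -/
def meanPremiumWait (φ : I) (n : ℕ) : ℝ≥0∞ := ∫⁻ ω, premiumWait ω n ∂Q.law φ

/-- Expected waiting time of the `n`-th customer if this customer joins the ordinary class. -/
def meanOrdinaryWait (φ : I) (n : ℕ) : ℝ≥0∞ := ∫⁻ ω, ordinaryWait ω n ∂Q.law φ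

/-- Steady-state expected waiting time `E[W_p]` in the premium class (the `limsup` is meant to be a
limit). -/
def Wp (φ : I) : ℝ≥0∞ := limsup (Q.meanPremiumWait φ) atTop

/-- Steady-state expected waiting time `E[W_o]` in the ordinary class (the `limsup` is meant to be a
limit). -/
def Wo (φ : I) : ℝ≥0∞ := limsup (Q.meanOrdinaryWait φ) atTop

/-- `C(φ) = E[W_o] - E[W_p]`. -/
def indifferenceCost (φ : I) : ℝ := (Q.Wo φ).toReal - (Q.Wp φ).toReal

/-! ### The game -/

/-- Expected cost, with premium fee `C`, of a customer who joins the premium class with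
probability `ψ` while a fraction `φ` of the population does. -/
def cost (C : ℝ) (ψ φ : I) : ℝ :=
  (ψ : ℝ) * ((Q.Wp φ).toReal + C) + (1 - (ψ : ℝ)) * (Q.Wo φ).toReal

def IsBestResponse (C : ℝ) (ψ φ : I) : Prop :=
  ∀ χ : I, Q.cost C ψ φ ≤ Q.cost C χ φ

def IsEquilibrium (C : ℝ) (φ : I) : Prop := Q.IsBestResponse C φ φ

/-- `φ` is a mixed equilibrium, and the game has no other equilibrium, pure or mixed. -/
def IsUniqueMixedEquilibrium (C : ℝ) (φ : I) : Prop :=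
  (0 < (φ : ℝ) ∧ (φ : ℝ) < 1) ∧ Q.IsEquilibrium C φ ∧ ∀ ψ : I, Q.IsEquilibrium C ψ → ψ = φ

/-- The strategy of a population in which a fraction `ε` plays `ψ` and the others play `φ`. -/
def invaded (ε φ ψ : I) : I :=
  ⟨(1 - (ε : ℝ)) * φ + ε * ψ,
    add_nonneg (mul_nonneg (sub_nonneg.2 ε.2.2) φ.2.1) (mul_nonneg ε.2.1 ψ.2.1), by
      nlinarith [mul_le_mul_of_nonneg_left φ.2.2 (sub_nonneg.2 ε.2.2),
        mul_le_mul_of_nonneg_left ψ.2.2 ε.2.1]⟩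

/-- Evolutionarily stable strategy: an equilibrium that cannot be invaded by any initially rare
strategy, and to which no other equilibrium strategy is a best response. -/
structure IsESS (C : ℝ) (φ : I) : Prop where
  equilibrium : Q.IsEquilibrium C φ
  not_invaded : ∀ ψ : I, ψ ≠ φ → ∃ ε₀ : ℝ, 0 < ε₀ ∧ ∀ ε : I, 0 < (ε : ℝ) → (ε : ℝ) < ε₀ →
    Q.cost C φ (invaded ε φ ψ) < Q.cost C ψ (invaded ε φ ψ)
  no_other : ∀ ψ : I, ψ ≠ φ → Q.IsEquilibrium C ψ → ¬ Q.IsBestResponse C ψ φ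

end MG1Queue

end

/-! The cost of a customer is affine in the customer's own strategy, with slope C - C(φ)
(`cost_sub_cost`). Hence 1 is an equilibrium iff C ≤ C(1), 0 is one iff C(0) ≤ C, and an interior φ
is one iff C(φ) = C. All difference quotients of the function C(φ) have the sign of 2 - K + ρ(2K -
2) (`indifferenceCost_sub`). A unique mixed equilibrium excludes both pure ones, so C(1) < C < C(0),
which forces this sign to be negative; conversely, a decreasing continuous C(φ) takes each
intermediate value exactly once. Invaders who buy premium more often lower C(φ) below the fee, and
those who buy it less often raise it above the fee, so both are punished: this is stability.

The analytic work is the formula for C(φ). Premium work is not affected by ordinary customers, and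
total work is not affected by the classes, so both follow Lindley recursions and their means tend to
Pollaczek–Khinchine values (`tendsto_posMoment_one_lindleyLaw`). For exponential gaps,
`expTrunc_succ` gives an exact drift equation for E[W²] + (2/λ)E[W]. Telescoping it bounds E[W] from
above; when the second moments of W stay bounded, it also bounds sup E[W] from below. That
boundedness requires a third moment of the requirement, which is removed by truncation.

The sojourn of an ordinary customer is a busy period of premium work, started by all work found plus
the own requirement (`sInf_busy_eq_iSup`). Its mean is the mean initial work divided by 1 - φρ
(`tendsto_busyMean`). This comes from conditioning on the first arrival, with a quadratic Lyapunov
function showing that the error of counting only N arrivals vanishes. The work found and the later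
arrivals are decoupled by `lintegral_stateAfter_seqShift`. -/

/-! ### Truncated moments of the exponential law -/

theorem ae_expMeasure_nonneg {lam : ℝ} : ∀ᵐ a ∂expMeasure lam, 0 ≤ a := by
  have h : expMeasure lam = volume.withDensity (exponentialPDF lam) := rfl
  have hm : Measurable (exponentialPDF lam) := (measurable_exponentialPDFReal lam).ennreal_ofReal
  rw [h, ae_withDensity_iff hm]
  refine ae_of_all _ fun a ha => ?_
  by_contra hneg
  exact ha (exponentialPDF_of_neg (not_le.1 hneg))

/-- `E[(v - A)^k; A < v]` for an exponential variable `A` of rate `lam`. -/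
noncomputable def expTrunc (lam : ℝ) (k : ℕ) (v : ℝ) : ℝ≥0∞ :=
  ∫⁻ a, if a < v then ENNReal.ofReal (v - a) ^ k else 0 ∂expMeasure lam

theorem expTrunc_eq_ofReal {lam : ℝ} (hlam : 0 < lam) (k : ℕ) {v : ℝ} (hv : 0 ≤ v) :
    expTrunc lam k v =
      ENNReal.ofReal (∫ a in (0 : ℝ)..v, (v - a) ^ k * (lam * Real.exp (-(lam * a)))) := by
  have h : expMeasure lam = volume.withDensity (exponentialPDF lam) := rfl
  have hm : Measurable (exponentialPDF lam) := (measurable_exponentialPDFReal lam).ennreal_ofReal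
  rw [intervalIntegral.integral_of_le hv, integral_Ioc_eq_integral_Ioo,
    ofReal_integral_eq_lintegral_ofReal, expTrunc, h, lintegral_withDensity_eq_lintegral_mul _ hm,
    ← lintegral_indicator measurableSet_Ioo]
  · refine lintegral_congr_ae ?_
    filter_upwards [compl_mem_ae_iff.2 (measure_singleton (μ := volume) (0 : ℝ))] with a ha
    have ha0 : a ≠ 0 := ha
    rcases lt_or_gt_of_ne ha0 with h0 | h0
    · simp [exponentialPDF_of_neg h0, Set.indicator, h0.not_gt]
    · by_cases hav : a < v
      · simp only [Pi.mul_apply, Set.indicator, Set.mem_Ioo, h0, hav, and_self, if_true,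
          exponentialPDF_of_nonneg h0.le]
        rw [← ENNReal.ofReal_pow (by linarith), ← ENNReal.ofReal_mul (by positivity), mul_comm]
      · simp [hav, Set.indicator]
  · refine Measurable.ite measurableSet_Iio ?_ measurable_const
    fun_prop
  · refine (Continuous.integrableOn_Icc (a := 0) (b := v) ?_).mono_set Set.Ioo_subset_Icc_self
    fun_prop
  · refine (ae_restrict_iff' measurableSet_Ioo).2 (ae_of_all _ fun a ha => ?_)
    have : 0 ≤ v - a := by linarith [ha.2]
    simp only [Pi.zero_apply]
    positivity

/-- Integration by parts: -(v - a)^(k+1) exp(-λa) is an antiderivative of the combined integrand,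
vanishing at a = v. This is the only property of the exponential law that the moment computations
need. -/
theorem expTrunc_succ {lam : ℝ} (hlam : 0 < lam) (k : ℕ) {v : ℝ} (hv : 0 ≤ v) :
    expTrunc lam (k + 1) v + (k + 1) * ENNReal.ofReal lam⁻¹ * expTrunc lam k v =
      ENNReal.ofReal v ^ (k + 1) := by
  have hnn : ∀ j : ℕ, 0 ≤ ∫ a in (0 : ℝ)..v, (v - a) ^ j * (lam * Real.exp (-(lam * a))) := by
    intro j
    refine intervalIntegral.integral_nonneg hv fun a ha => ?_
    have : 0 ≤ v - a := by linarith [ha.2]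
    positivity
  have hint : ∀ j : ℕ, IntervalIntegrable
      (fun a : ℝ => (v - a) ^ j * (lam * Real.exp (-(lam * a)))) volume 0 v := fun j =>
    Continuous.intervalIntegrable (by fun_prop) _ _
  have hftc : ∫ a in (0 : ℝ)..v, ((v - a) ^ (k + 1) * (lam * Real.exp (-(lam * a))) +
      ((k + 1) * lam⁻¹) * ((v - a) ^ k * (lam * Real.exp (-(lam * a))))) = v ^ (k + 1) := by
    rw [intervalIntegral.integral_eq_sub_of_hasDerivAt
      (f := fun a => -((v - a) ^ (k + 1) * Real.exp (-(lam * a))))]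
    · simp
    · intro a _
      have h1 : HasDerivAt (fun a : ℝ => (v - a) ^ (k + 1))
          (((k + 1 : ℕ) : ℝ) * (v - a) ^ k * (-1)) a := by
        simpa using ((hasDerivAt_id a).const_sub v).fun_pow (k + 1)
      have h2 : HasDerivAt (fun a : ℝ => Real.exp (-(lam * a)))
          (Real.exp (-(lam * a)) * (-(lam * 1))) a :=
        (((hasDerivAt_id a).const_mul lam).neg).exp
      refine (h1.mul h2).neg.congr_deriv ?_
      push_cast
      field_simp
      ring
    · exact (hint (k + 1)).add ((hint k).const_mul _)
  rw [expTrunc_eq_ofReal hlam _ hv, expTrunc_eq_ofReal hlam _ hv, ← ENNReal.ofReal_pow hv, ← hftc,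
    intervalIntegral.integral_add (hint _) ((hint k).const_mul _),
    intervalIntegral.integral_const_mul, ENNReal.ofReal_add (hnn _)
      (mul_nonneg (by positivity) (hnn k)), ENNReal.ofReal_mul (by positivity),
    ENNReal.ofReal_mul (by positivity)]
  congr 3
  rw [ENNReal.ofReal_add (by positivity) zero_le_one]
  simp

/-! ### Sequences of extended non-negative reals -/

theorem ENNReal.le_of_forall_natCast_mul_le {x D A : ℝ≥0∞} (hA : A ≠ ⊤)
    (h : ∀ N : ℕ, N * x ≤ A + N * D) : x ≤ D := by
  have hlim : Tendsto (fun N : ℕ => A * ((N : ℝ≥0∞))⁻¹ + D) atTop (𝓝 (A * 0 + D)) :=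
    (ENNReal.Tendsto.const_mul ENNReal.tendsto_inv_nat_nhds_zero (Or.inr hA)).add_const D
  rw [mul_zero, zero_add] at hlim
  refine ge_of_tendsto hlim ?_
  filter_upwards [eventually_ge_atTop 1] with N hN
  have hN0 : (N : ℝ≥0∞) ≠ 0 := by exact_mod_cast (by omega : N ≠ 0)
  have hNt : (N : ℝ≥0∞) ≠ ⊤ := ENNReal.natCast_ne_top N
  calc x = (N : ℝ≥0∞)⁻¹ * (N * x) := by
        rw [← mul_assoc, ENNReal.inv_mul_cancel hN0 hNt, one_mul]
    _ ≤ (N : ℝ≥0∞)⁻¹ * (A + N * D) := by gcongr; exact h N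
    _ = A * (N : ℝ≥0∞)⁻¹ + D := by
        rw [mul_add, ← mul_assoc, ENNReal.inv_mul_cancel hN0 hNt, one_mul, mul_comm]

/-- Summed form of a drift inequality. -/
theorem ENNReal.sum_drift_le {a g : ℕ → ℝ≥0∞} {c D : ℝ≥0∞} (h0 : a 0 = 0)
    (h : ∀ n, a (n + 1) + c * g n ≤ a n + D) (N : ℕ) :
    a N + c * ∑ n ∈ Finset.range N, g n ≤ N * D := by
  induction N with
  | zero => simp [h0]
  | succ N ih =>
    rw [Finset.sum_range_succ, mul_add]
    calc a (N + 1) + (c * ∑ n ∈ Finset.range N, g n + c * g N)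
        = a (N + 1) + c * g N + c * ∑ n ∈ Finset.range N, g n := by ring
      _ ≤ a N + D + c * ∑ n ∈ Finset.range N, g n := by gcongr ?_ + _; exact h N
      _ = a N + c * ∑ n ∈ Finset.range N, g n + D := by ring
      _ ≤ N * D + D := by gcongr
      _ = ((N + 1 : ℕ) : ℝ≥0∞) * D := by push_cast; ring

/-- By monotonicity, N of the first n + N terms are at least `g n`. The summed drift then gives N c
g(n) ≤ (n + N) D, and dividing by N → ∞ removes the nD. -/
theorem ENNReal.mul_le_of_drift {a g : ℕ → ℝ≥0∞} {c D : ℝ≥0∞} (h0 : a 0 = 0)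
    (hg : Monotone g) (h : ∀ n, a (n + 1) + c * g n ≤ a n + D) (n : ℕ) : c * g n ≤ D := by
  rcases eq_or_ne D ⊤ with hD | hD
  · simp [hD]
  refine ENNReal.le_of_forall_natCast_mul_le (A := n * D)
    (ENNReal.mul_ne_top (ENNReal.natCast_ne_top n) hD) fun N => ?_
  have h1 : ∑ _k ∈ Finset.range N, g n ≤ ∑ k ∈ Finset.range (n + N), g k := by
    rw [Finset.sum_range_add]
    exact (Finset.sum_le_sum fun k _ => hg (Nat.le_add_right n k)).trans le_add_self
  calc N * (c * g n) = c * ∑ _k ∈ Finset.range N, g n := by simp; ring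
    _ ≤ c * ∑ k ∈ Finset.range (n + N), g k := by gcongr
    _ ≤ _ := le_add_self.trans (ENNReal.sum_drift_le h0 h (n + N))
    _ = n * D + N * D := by push_cast; ring

/-- With an exact drift and `a` bounded, the telescoped identity N D = a(N) + c ∑ g loses only a
bounded term, negligible after division by N. -/
theorem ENNReal.le_mul_of_drift {a g : ℕ → ℝ≥0∞} {c D B M : ℝ≥0∞} (h0 : a 0 = 0) (hB : B ≠ ⊤)
    (haB : ∀ n, a n ≤ B) (hg : ∀ n, g n ≤ M) (h : ∀ n, a (n + 1) + c * g n = a n + D) :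
    D ≤ c * M := by
  refine ENNReal.le_of_forall_natCast_mul_le hB fun N => ?_
  have h1 : ∀ N : ℕ, a N + c * ∑ n ∈ Finset.range N, g n = N * D := by
    intro N
    induction N with
    | zero => simp [h0]
    | succ N ih =>
      rw [Finset.sum_range_succ, mul_add, add_comm (c * _), ← add_assoc, h N, add_right_comm, ih]
      push_cast; ring
  rw [← h1 N]
  calc a N + c * ∑ n ∈ Finset.range N, g n ≤ B + c * ∑ _n ∈ Finset.range N, M := by
        gcongr
        · exact haB N
        · exact hg _
    _ = B + N * (c * M) := by simp; ring

/-! ### The Lindley recursion with exponential gaps -/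

/-- Law of the `n`-th term of the Lindley recursion `W (n + 1) = (W n + U n - A n)⁺`,
`W 0 = 0`, with i.i.d. requirements `U n` of law `ν` and exponential gaps `A n`. -/
noncomputable def lindleyLaw (lam : ℝ) (ν : Measure ℝ) : ℕ → Measure ℝ
  | 0 => Measure.dirac 0
  | n + 1 => ((lindleyLaw lam ν n).prod (ν.prod (expMeasure lam))).map
      fun p => max (p.1 + p.2.1 - p.2.2) 0

/-- Transition operator of the Lindley recursion. -/
noncomputable def lindleyStep (lam : ℝ) (ν : Measure ℝ) (g : ℝ → ℝ≥0∞) (w : ℝ) : ℝ≥0∞ :=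
  ∫⁻ u, ∫⁻ a, g (max (w + u - a) 0) ∂expMeasure lam ∂ν

/-- `k`-th moment of a measure on the real line, restricted to the positive half-line. -/
noncomputable def posMoment (k : ℕ) (ν : Measure ℝ) : ℝ≥0∞ := ∫⁻ u, ENNReal.ofReal u ^ k ∂ν

section Lindley

variable {lam : ℝ} {ν ν' : Measure ℝ}

theorem isProbabilityMeasure_lindleyLaw [IsProbabilityMeasure ν] (hlam : 0 < lam) (n : ℕ) :
    IsProbabilityMeasure (lindleyLaw lam ν n) := by
  have := isProbabilityMeasure_expMeasure hlam
  induction n with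
  | zero => exact inferInstanceAs (IsProbabilityMeasure (Measure.dirac (0 : ℝ)))
  | succ n ih => exact Measure.isProbabilityMeasure_map (by fun_prop)

theorem ae_lindleyLaw_nonneg (n : ℕ) : ∀ᵐ w ∂lindleyLaw lam ν n, 0 ≤ w := by
  cases n with
  | zero => exact (ae_dirac_iff measurableSet_Ici).2 le_rfl
  | succ n =>
    exact (ae_map_iff (by fun_prop) measurableSet_Ici).2 (ae_of_all _ fun _ => le_max_right _ _)

theorem lintegral_lindleyLaw_succ [IsProbabilityMeasure ν] (hlam : 0 < lam) (n : ℕ) {g : ℝ → ℝ≥0∞}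
    (hg : Measurable g) :
    ∫⁻ w, g w ∂lindleyLaw lam ν (n + 1) = ∫⁻ w, lindleyStep lam ν g w ∂lindleyLaw lam ν n := by
  have := isProbabilityMeasure_expMeasure hlam
  rw [lindleyLaw, lintegral_map hg (by fun_prop), lintegral_prod _ (by fun_prop)]
  refine lintegral_congr fun w => ?_
  rw [lintegral_prod _ (by fun_prop), lindleyStep]

theorem Monotone.lindleyStep {g : ℝ → ℝ≥0∞} (hg : Monotone g) :
    Monotone (lindleyStep lam ν g) := fun w w' h =>
  lintegral_mono fun u => lintegral_mono fun a =>
    hg (max_le_max_right 0 (by linarith))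

/-- The recursion starts at its lowest state, so one step can only increase the law stochastically;
the transition operator preserves monotone functions and propagates this order. -/
theorem monotone_lintegral_lindleyLaw [IsProbabilityMeasure ν] (hlam : 0 < lam) {g : ℝ → ℝ≥0∞}
    (hg : Monotone g) :
    Monotone fun n => ∫⁻ w, g w ∂lindleyLaw lam ν n := by
  refine monotone_nat_of_le_succ fun n => ?_
  induction n generalizing g with
  | zero =>
    have h0 : ∫⁻ w, g w ∂lindleyLaw lam ν 0 = g 0 := by
      rw [lindleyLaw, lintegral_dirac' _ hg.measurable]
    have := isProbabilityMeasure_lindleyLaw (ν := ν) hlam 1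
    calc ∫⁻ w, g w ∂lindleyLaw lam ν 0 = ∫⁻ _w, g 0 ∂lindleyLaw lam ν 1 := by simp [h0]
      _ ≤ ∫⁻ w, g w ∂lindleyLaw lam ν 1 :=
        lintegral_mono_ae ((ae_lindleyLaw_nonneg 1).mono fun w hw => hg hw)
  | succ n ih =>
    rw [lintegral_lindleyLaw_succ hlam n hg.measurable,
      lintegral_lindleyLaw_succ hlam (n + 1) hg.measurable]
    exact ih hg.lindleyStep

/-- A stochastically larger requirement leads to stochastically larger work. -/
theorem lintegral_lindleyLaw_mono [IsProbabilityMeasure ν] [IsProbabilityMeasure ν']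
    (hlam : 0 < lam)
    (hν : ∀ f : ℝ → ℝ≥0∞, Monotone f → ∫⁻ u, f u ∂ν ≤ ∫⁻ u, f u ∂ν') (n : ℕ)
    {g : ℝ → ℝ≥0∞} (hg : Monotone g) :
    ∫⁻ w, g w ∂lindleyLaw lam ν n ≤ ∫⁻ w, g w ∂lindleyLaw lam ν' n := by
  induction n generalizing g with
  | zero => exact le_rfl
  | succ n ih =>
    rw [lintegral_lindleyLaw_succ hlam n hg.measurable,
      lintegral_lindleyLaw_succ hlam n hg.measurable]
    calc ∫⁻ w, lindleyStep lam ν g w ∂lindleyLaw lam ν n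
        ≤ ∫⁻ w, lindleyStep lam ν' g w ∂lindleyLaw lam ν n := by
          refine lintegral_mono fun w => hν _ fun u u' h => lintegral_mono fun a => ?_
          exact hg (max_le_max_right 0 (by linarith))
      _ ≤ _ := ih hg.lindleyStep

theorem monotone_ofReal_pow (k : ℕ) : Monotone fun x : ℝ => ENNReal.ofReal x ^ k :=
  fun _ _ h => pow_le_pow_left' (ENNReal.ofReal_le_ofReal h) k

/-- This is `expTrunc_succ` at v = W + U, averaged over W and U. For k = 0 it would fail: 0⁰ = 1
also counts the event that the system empties. -/
theorem posMoment_lindleyLaw_succ [IsProbabilityMeasure ν] (hlam : 0 < lam) (hν : ∀ᵐ u ∂ν, 0 ≤ u)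
    {k : ℕ} (hk : k ≠ 0)
    (n : ℕ) :
    posMoment (k + 1) (lindleyLaw lam ν (n + 1)) +
      (k + 1) * ENNReal.ofReal lam⁻¹ * posMoment k (lindleyLaw lam ν (n + 1)) =
    ∫⁻ w, ∫⁻ u, (ENNReal.ofReal w + ENNReal.ofReal u) ^ (k + 1) ∂ν ∂lindleyLaw lam ν n := by
  have := isProbabilityMeasure_expMeasure hlam
  have hmeas : ∀ j : ℕ, Measurable (lindleyStep lam ν fun x => ENNReal.ofReal x ^ j) := fun j =>
    (monotone_ofReal_pow j).lindleyStep.measurable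
  have hI : ∀ (j : ℕ) (_ : j ≠ 0) (v : ℝ),
      ∫⁻ a, ENNReal.ofReal (max (v - a) 0) ^ j ∂expMeasure lam = expTrunc lam j v := by
    intro j hj v
    refine lintegral_congr fun a => ?_
    split_ifs with h
    · rw [max_eq_left (by linarith)]
    · rw [max_eq_right (by linarith), ENNReal.ofReal_zero, zero_pow hj]
  have hin : ∀ w : ℝ, Measurable fun u => expTrunc lam k (w + u) := fun w => by
    simp_rw [← hI k hk]
    exact Measurable.lintegral_prod_right'
      (f := fun p : ℝ × ℝ => ENNReal.ofReal (max (w + p.1 - p.2) 0) ^ k) (by fun_prop)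
  unfold posMoment
  rw [lintegral_lindleyLaw_succ hlam n (by fun_prop),
    lintegral_lindleyLaw_succ hlam n (by fun_prop),
    ← lintegral_const_mul _ (hmeas k), ← lintegral_add_left (hmeas (k + 1))]
  refine lintegral_congr_ae ?_
  filter_upwards [ae_lindleyLaw_nonneg n] with w hw
  simp only [lindleyStep, hI k hk, hI (k + 1) k.succ_ne_zero]
  rw [← lintegral_const_mul _ (hin w), ← lintegral_add_right _ ((hin w).const_mul _)]
  refine lintegral_congr_ae ?_
  filter_upwards [hν] with u hu
  rw [expTrunc_succ hlam k (add_nonneg hw hu),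
    ENNReal.ofReal_add hw hu]

theorem lintegral_lintegral_add_sq [IsProbabilityMeasure ν] (ξ : Measure ℝ)
    [IsProbabilityMeasure ξ] :
    ∫⁻ w, ∫⁻ u, (ENNReal.ofReal w + ENNReal.ofReal u) ^ 2 ∂ν ∂ξ =
      posMoment 2 ξ + 2 * posMoment 1 ν * posMoment 1 ξ + posMoment 2 ν := by
  have h1 : ∀ x : ℝ≥0∞, ∫⁻ u, (x + ENNReal.ofReal u) ^ 2 ∂ν =
      x ^ 2 + 2 * posMoment 1 ν * x + posMoment 2 ν := by
    intro x
    simp_rw [add_sq]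
    rw [lintegral_add_left (by fun_prop), lintegral_add_left (by fun_prop),
      lintegral_const_mul _ (by fun_prop)]
    simp [posMoment]
    ring
  simp_rw [h1]
  rw [lintegral_add_left (by fun_prop), lintegral_add_left (by fun_prop),
    lintegral_const_mul _ (by fun_prop)]
  simp [posMoment]

theorem lintegral_lintegral_add_cube [IsProbabilityMeasure ν] (ξ : Measure ℝ)
    [IsProbabilityMeasure ξ] :
    ∫⁻ w, ∫⁻ u, (ENNReal.ofReal w + ENNReal.ofReal u) ^ 3 ∂ν ∂ξ =
      posMoment 3 ξ + 3 * posMoment 1 ν * posMoment 2 ξ + 3 * posMoment 2 ν * posMoment 1 ξ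
        + posMoment 3 ν := by
  have h1 : ∀ x : ℝ≥0∞, ∫⁻ u, (x + ENNReal.ofReal u) ^ 3 ∂ν =
      x ^ 3 + 3 * posMoment 1 ν * x ^ 2 + 3 * posMoment 2 ν * x + posMoment 3 ν := by
    intro x
    have h3 : ∀ y : ℝ≥0∞, (x + y) ^ 3 = x ^ 3 + 3 * x ^ 2 * y + 3 * x * y ^ 2 + y ^ 3 :=
      fun y => by ring
    simp_rw [h3]
    rw [lintegral_add_left (by fun_prop), lintegral_add_left (by fun_prop),
      lintegral_add_left (by fun_prop), lintegral_const_mul _ (by fun_prop),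
      lintegral_const_mul _ (by fun_prop)]
    simp [posMoment]
    ring
  simp_rw [h1]
  rw [lintegral_add_left (by fun_prop), lintegral_add_left (by fun_prop),
    lintegral_add_left (by fun_prop), lintegral_const_mul _ (by fun_prop),
    lintegral_const_mul _ (by fun_prop)]
  simp [posMoment]

theorem posMoment_lindleyLaw_zero {k : ℕ} (hk : k ≠ 0) :
    posMoment k (lindleyLaw lam ν 0) = 0 := by
  simp [posMoment, lindleyLaw, hk]

theorem monotone_posMoment_lindleyLaw [IsProbabilityMeasure ν] (hlam : 0 < lam) (k : ℕ) :
    Monotone fun n => posMoment k (lindleyLaw lam ν n) :=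
  monotone_lintegral_lindleyLaw hlam (monotone_ofReal_pow k)

/-- The drift equation for the Lyapunov function W² + (2/λ)W. Here δ is the mean idle capacity per
arrival; naming it by an addition avoids truncated subtraction. -/
theorem lindley_drift_sq [IsProbabilityMeasure ν] (hlam : 0 < lam) (hν : ∀ᵐ u ∂ν, 0 ≤ u) {δ : ℝ≥0∞}
    (hδ : posMoment 1 ν + δ = ENNReal.ofReal lam⁻¹) (n : ℕ) :
    (posMoment 2 (lindleyLaw lam ν (n + 1)) +
        2 * ENNReal.ofReal lam⁻¹ * posMoment 1 (lindleyLaw lam ν (n + 1)))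
      + 2 * δ * posMoment 1 (lindleyLaw lam ν n) =
    (posMoment 2 (lindleyLaw lam ν n) +
        2 * ENNReal.ofReal lam⁻¹ * posMoment 1 (lindleyLaw lam ν n)) + posMoment 2 ν := by
  have := isProbabilityMeasure_lindleyLaw (ν := ν) hlam n
  have h := posMoment_lindleyLaw_succ hlam hν one_ne_zero n
  rw [lintegral_lintegral_add_sq] at h
  norm_num at h
  rw [h, ← hδ]
  ring

/-- Upper bound in the Pollaczek–Khinchine formula. -/
theorem mul_posMoment_one_lindleyLaw_le [IsProbabilityMeasure ν] (hlam : 0 < lam)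
    (hν : ∀ᵐ u ∂ν, 0 ≤ u) {δ : ℝ≥0∞}
    (hδ : posMoment 1 ν + δ = ENNReal.ofReal lam⁻¹) (n : ℕ) :
    2 * δ * posMoment 1 (lindleyLaw lam ν n) ≤ posMoment 2 ν :=
  ENNReal.mul_le_of_drift
    (a := fun n => posMoment 2 (lindleyLaw lam ν n) +
      2 * ENNReal.ofReal lam⁻¹ * posMoment 1 (lindleyLaw lam ν n))
    (g := fun n => posMoment 1 (lindleyLaw lam ν n))
    (by simp [posMoment_lindleyLaw_zero]) (monotone_posMoment_lindleyLaw hlam 1)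
    (fun n => (lindley_drift_sq hlam hν hδ n).le) n

/-- The same drift argument one degree higher. It supplies the uniform bound on second moments that
the lower bound of Pollaczek–Khinchine needs. -/
theorem mul_posMoment_two_lindleyLaw_le [IsProbabilityMeasure ν] (hlam : 0 < lam)
    (hν : ∀ᵐ u ∂ν, 0 ≤ u) {δ M : ℝ≥0∞}
    (hδ : posMoment 1 ν + δ = ENNReal.ofReal lam⁻¹)
    (hM : ∀ n, posMoment 1 (lindleyLaw lam ν n) ≤ M) (n : ℕ) :
    3 * δ * posMoment 2 (lindleyLaw lam ν n) ≤ 3 * posMoment 2 ν * M + posMoment 3 ν := by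
  refine ENNReal.mul_le_of_drift
    (a := fun n => posMoment 3 (lindleyLaw lam ν n) +
      3 * ENNReal.ofReal lam⁻¹ * posMoment 2 (lindleyLaw lam ν n))
    (g := fun n => posMoment 2 (lindleyLaw lam ν n))
    (by simp [posMoment_lindleyLaw_zero]) (monotone_posMoment_lindleyLaw hlam 2)
    (fun n => ?_) n
  have := isProbabilityMeasure_lindleyLaw (ν := ν) hlam n
  have h := posMoment_lindleyLaw_succ hlam hν two_ne_zero n
  rw [lintegral_lintegral_add_cube] at h
  norm_num at h
  rw [h]
  calc posMoment 3 (lindleyLaw lam ν n) + 3 * posMoment 1 ν * posMoment 2 (lindleyLaw lam ν n)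
        + 3 * posMoment 2 ν * posMoment 1 (lindleyLaw lam ν n) + posMoment 3 ν
        + 3 * δ * posMoment 2 (lindleyLaw lam ν n)
      = posMoment 3 (lindleyLaw lam ν n) + 3 * ENNReal.ofReal lam⁻¹ *
          posMoment 2 (lindleyLaw lam ν n)
        + (3 * posMoment 2 ν * posMoment 1 (lindleyLaw lam ν n) + posMoment 3 ν) := by
        rw [← hδ]; ring
    _ ≤ _ := by gcongr; exact hM n

/-- Lower bound in the Pollaczek–Khinchine formula, for requirements with a third moment. -/
theorem posMoment_two_le_of_third_moment [IsProbabilityMeasure ν] (hlam : 0 < lam)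
    (hν : ∀ᵐ u ∂ν, 0 ≤ u) {δ M : ℝ≥0∞}
    (hδ : posMoment 1 ν + δ = ENNReal.ofReal lam⁻¹) (hδ0 : δ ≠ 0) (h2 : posMoment 2 ν ≠ ⊤)
    (h3 : posMoment 3 ν ≠ ⊤) (hMt : M ≠ ⊤)
    (hM : ∀ n, posMoment 1 (lindleyLaw lam ν n) ≤ M) :
    posMoment 2 ν ≤ 2 * δ * M := by
  have hδt : δ ≠ ⊤ := ne_top_of_le_ne_top ENNReal.ofReal_ne_top (hδ ▸ le_add_self)
  have hB : 3 * posMoment 2 ν * M + posMoment 3 ν ≠ ⊤ := by finiteness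
  have hq : ∀ n, posMoment 2 (lindleyLaw lam ν n) ≤
      (3 * posMoment 2 ν * M + posMoment 3 ν) / (3 * δ) := fun n => by
    rw [ENNReal.le_div_iff_mul_le (Or.inl (by simp [hδ0])) (Or.inl (by finiteness)), mul_comm]
    exact mul_posMoment_two_lindleyLaw_le hlam hν hδ hM n
  refine ENNReal.le_mul_of_drift
    (a := fun n => posMoment 2 (lindleyLaw lam ν n) +
      2 * ENNReal.ofReal lam⁻¹ * posMoment 1 (lindleyLaw lam ν n))
    (g := fun n => posMoment 1 (lindleyLaw lam ν n))
    (B := (3 * posMoment 2 ν * M + posMoment 3 ν) / (3 * δ) + 2 * ENNReal.ofReal lam⁻¹ * M)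
    (by simp [posMoment_lindleyLaw_zero]) ?_ (fun n => ?_) hM
    (fun n => lindley_drift_sq hlam hν hδ n)
  · exact ENNReal.add_ne_top.2 ⟨ENNReal.div_ne_top hB (by simp [hδ0]), by finiteness⟩
  · exact add_le_add (hq n) (by gcongr; exact hM n)

theorem tendsto_posMoment_map_min (k : ℕ) :
    Tendsto (fun b : ℕ => posMoment k (ν.map fun u => min u b)) atTop (𝓝 (posMoment k ν)) := by
  have h : ∀ b : ℕ, posMoment k (ν.map fun u => min u b) =
      ∫⁻ u, ENNReal.ofReal (min u b) ^ k ∂ν := fun b =>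
    lintegral_map (by fun_prop) (by fun_prop)
  simp_rw [h]
  refine lintegral_tendsto_of_tendsto_of_monotone (fun b => by fun_prop)
    (ae_of_all _ fun u b b' hb => monotone_ofReal_pow k
      (min_le_min_left u (by exact_mod_cast hb))) (ae_of_all _ fun u => ?_)
  refine tendsto_const_nhds.congr' ?_
  filter_upwards [eventually_ge_atTop ⌈u⌉₊] with b hb
  rw [min_eq_left ((Nat.le_ceil u).trans (by exact_mod_cast hb))]

/-- Pollaczek–Khinchine formula for the limit of the mean work found. -/
theorem tendsto_posMoment_one_lindleyLaw [IsProbabilityMeasure ν] (hlam : 0 < lam)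
    (hν : ∀ᵐ u ∂ν, 0 ≤ u)
    (hstable : posMoment 1 ν < ENNReal.ofReal lam⁻¹) (h2 : posMoment 2 ν ≠ ⊤) :
    Tendsto (fun n => posMoment 1 (lindleyLaw lam ν n)) atTop
      (𝓝 (posMoment 2 ν / (2 * (ENNReal.ofReal lam⁻¹ - posMoment 1 ν)))) := by
  set δ := ENNReal.ofReal lam⁻¹ - posMoment 1 ν with hδdef
  have hδ : posMoment 1 ν + δ = ENNReal.ofReal lam⁻¹ := add_tsub_cancel_of_le hstable.le
  have hδ0 : δ ≠ 0 := (tsub_pos_of_lt hstable).ne'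
  have hδt : δ ≠ ⊤ := ne_top_of_le_ne_top ENNReal.ofReal_ne_top tsub_le_self
  have h2δ0 : 2 * δ ≠ 0 := by simp [hδ0]
  have h2δt : 2 * δ ≠ ⊤ := by finiteness
  have hle : ∀ n, posMoment 1 (lindleyLaw lam ν n) ≤ posMoment 2 ν / (2 * δ) := fun n => by
    rw [ENNReal.le_div_iff_mul_le (Or.inl h2δ0) (Or.inl h2δt), mul_comm]
    exact mul_posMoment_one_lindleyLaw_le hlam hν hδ n
  have hsup := tendsto_atTop_iSup (monotone_posMoment_lindleyLaw (ν := ν) hlam 1)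
  set M := ⨆ n, posMoment 1 (lindleyLaw lam ν n) with hMdef
  have hMle : M ≤ posMoment 2 ν / (2 * δ) := iSup_le hle
  have hMt : M ≠ ⊤ := ne_top_of_le_ne_top (ENNReal.div_ne_top h2 h2δ0) hMle
  suffices posMoment 2 ν ≤ 2 * δ * M by
    rwa [le_antisymm hMle (ENNReal.div_le_of_le_mul' this)] at hsup
  -- Requirements cut off at b have all moments, and their work is stochastically below the original
  -- one, so M still bounds its mean. The term with the first moment is kept on the left so that b →
  -- ∞ involves no subtraction; it is cancelled at the end.
  have hkey : ∀ b : ℕ, posMoment 2 (ν.map fun u => min u b) +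
      2 * posMoment 1 (ν.map fun u => min u b) * M ≤ 2 * ENNReal.ofReal lam⁻¹ * M := by
    intro b
    set νb := ν.map fun u => min u (b : ℝ) with hνb
    have : IsProbabilityMeasure νb := Measure.isProbabilityMeasure_map (by fun_prop)
    have hdom : ∀ f : ℝ → ℝ≥0∞, Monotone f → ∫⁻ u, f u ∂νb ≤ ∫⁻ u, f u ∂ν := fun f hf => by
      rw [hνb, lintegral_map hf.measurable (by fun_prop)]
      exact lintegral_mono fun u => hf (min_le_left _ _)
    have hnn : ∀ᵐ u ∂νb, 0 ≤ u := by
      rw [hνb, ae_map_iff (by fun_prop) measurableSet_Ici]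
      exact hν.mono fun u hu => le_min hu b.cast_nonneg
    have hfin : ∀ k, posMoment k νb ≠ ⊤ := fun k => by
      have hb : posMoment k νb ≤ ∫⁻ _u, ENNReal.ofReal b ^ k ∂ν := by
        rw [hνb, posMoment, lintegral_map (by fun_prop) (by fun_prop)]
        exact lintegral_mono fun u => monotone_ofReal_pow k (min_le_right _ _)
      refine ne_top_of_le_ne_top ?_ hb
      rw [lintegral_const, measure_univ, mul_one]
      finiteness
    have hlt : posMoment 1 νb < ENNReal.ofReal lam⁻¹ :=
      (hdom _ (monotone_ofReal_pow 1)).trans_lt hstable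
    have hδb : posMoment 1 νb + (ENNReal.ofReal lam⁻¹ - posMoment 1 νb) = ENNReal.ofReal lam⁻¹ :=
      add_tsub_cancel_of_le hlt.le
    have := posMoment_two_le_of_third_moment hlam hnn hδb (tsub_pos_of_lt hlt).ne' (hfin 2)
      (hfin 3) hMt fun n => (lintegral_lindleyLaw_mono hlam hdom n (monotone_ofReal_pow 1)).trans
        (le_iSup (fun n => posMoment 1 (lindleyLaw lam ν n)) n)
    calc _ ≤ 2 * (ENNReal.ofReal lam⁻¹ - posMoment 1 νb) * M + 2 * posMoment 1 νb * M := by gcongr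
      _ = 2 * (posMoment 1 νb + (ENNReal.ofReal lam⁻¹ - posMoment 1 νb)) * M := by ring
      _ = _ := by rw [hδb]
  have hm1 : posMoment 1 ν ≠ ⊤ := ne_top_of_lt hstable
  have hlim := (tendsto_posMoment_map_min (ν := ν) 2).add
    (ENNReal.Tendsto.mul_const (b := M)
      (ENNReal.Tendsto.const_mul (a := 2) (tendsto_posMoment_map_min (ν := ν) 1)
        (Or.inr ENNReal.ofNat_ne_top)) (Or.inr hMt))
  have hfinal := le_of_tendsto' hlim hkey
  have hfin : 2 * posMoment 1 ν * M ≠ ⊤ := by finiteness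
  refine (ENNReal.add_le_add_iff_right hfin).1 (hfinal.trans_eq ?_)
  rw [← hδ]
  ring

end Lindley

/-! ### Mean length of a busy period -/

/-- Mean length of a busy period with initial work `v`, when only the first `N` arrivals count. -/
noncomputable def busyMean (lam : ℝ) (ν : Measure ℝ) : ℕ → ℝ → ℝ≥0∞
  | 0, v => ENNReal.ofReal v
  | N + 1, v => ∫⁻ a, if a < v then ENNReal.ofReal a + ∫⁻ u, busyMean lam ν N (v - a + u) ∂ν
      else ENNReal.ofReal v ∂expMeasure lam

/-- Mean work just after the `N`-th arrival, on the event that the busy period with initial work `v`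
lasts until then. -/
noncomputable def busyRemainder (lam : ℝ) (ν : Measure ℝ) : ℕ → ℝ → ℝ≥0∞
  | 0, v => ENNReal.ofReal v
  | N + 1, v => ∫⁻ a, if a < v then ∫⁻ u, busyRemainder lam ν N (v - a + u) ∂ν
      else 0 ∂expMeasure lam

section BusyPeriod

variable {lam : ℝ} {ν : Measure ℝ}

theorem measurable_lintegral_add [SFinite ν] {g : ℝ → ℝ≥0∞} (hg : Measurable g) :
    Measurable fun z => ∫⁻ u, g (z + u) ∂ν :=
  Measurable.lintegral_prod_right' (f := fun p : ℝ × ℝ => g (p.1 + p.2)) (by fun_prop)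

theorem measurable_busyMean [IsProbabilityMeasure ν] (hlam : 0 < lam) (N : ℕ) :
    Measurable (busyMean lam ν N) := by
  have := isProbabilityMeasure_expMeasure hlam
  induction N with
  | zero => exact ENNReal.measurable_ofReal
  | succ N ih =>
    have h := measurable_lintegral_add (ν := ν) ih
    refine Measurable.lintegral_prod_right' (f := fun p : ℝ × ℝ => if p.2 < p.1 then
      ENNReal.ofReal p.2 + ∫⁻ u, busyMean lam ν N (p.1 - p.2 + u) ∂ν else ENNReal.ofReal p.1) ?_
    refine Measurable.ite (measurableSet_lt measurable_snd measurable_fst) ?_ (by fun_prop)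
    exact (by fun_prop : Measurable fun p : ℝ × ℝ => ENNReal.ofReal p.2).add
      (h.comp (measurable_fst.sub measurable_snd))

theorem measurable_busyRemainder [IsProbabilityMeasure ν] (hlam : 0 < lam) (N : ℕ) :
    Measurable (busyRemainder lam ν N) := by
  have := isProbabilityMeasure_expMeasure hlam
  induction N with
  | zero => exact ENNReal.measurable_ofReal
  | succ N ih =>
    have h := measurable_lintegral_add (ν := ν) ih
    refine Measurable.lintegral_prod_right' (f := fun p : ℝ × ℝ => if p.2 < p.1 then
      ∫⁻ u, busyRemainder lam ν N (p.1 - p.2 + u) ∂ν else 0) ?_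
    exact Measurable.ite (measurableSet_lt measurable_snd measurable_fst)
      (h.comp (measurable_fst.sub measurable_snd)) measurable_const

theorem lintegral_ofReal_add [IsProbabilityMeasure ν] (hν : ∀ᵐ u ∂ν, 0 ≤ u) {z : ℝ} (hz : 0 ≤ z) :
    ∫⁻ u, ENNReal.ofReal (z + u) ∂ν = ENNReal.ofReal z + posMoment 1 ν := by
  calc ∫⁻ u, ENNReal.ofReal (z + u) ∂ν = ∫⁻ u, (ENNReal.ofReal z + ENNReal.ofReal u) ∂ν :=
        lintegral_congr_ae (hν.mono fun u hu => ENNReal.ofReal_add hz hu)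
    _ = _ := by rw [lintegral_add_left (by fun_prop)]; simp [posMoment]

/-- Here κ plays the role of 1/(1 - r). Work left after the N-th arrival is counted once in
`busyMean`, but would generate κ times its size if later arrivals counted; the defect is κ - 1 = κr
times the remainder. -/
theorem busyMean_add_busyRemainder [IsProbabilityMeasure ν] (hlam : 0 < lam)
    (hν : ∀ᵐ u ∂ν, 0 ≤ u) {κ r : ℝ≥0∞} (hr : posMoment 1 ν = r * ENNReal.ofReal lam⁻¹)
    (hκ : κ = 1 + κ * r) (N : ℕ) {v : ℝ} (hv : 0 ≤ v) :
    busyMean lam ν N v + κ * r * busyRemainder lam ν N v = κ * ENNReal.ofReal v := by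
  have := isProbabilityMeasure_expMeasure hlam
  induction N generalizing v with
  | zero =>
    rw [busyMean, busyRemainder]
    nth_rw 2 [hκ]
    ring
  | succ N ih =>
    have hD := measurable_lintegral_add (ν := ν) (measurable_busyRemainder (ν := ν) hlam N)
    have hDm : Measurable fun a => if a < v then ∫⁻ u, busyRemainder lam ν N (v - a + u) ∂ν
        else 0 :=
      Measurable.ite measurableSet_Iio (hD.comp (measurable_const.sub measurable_id))
        measurable_const
    have hI : ∀ k, Measurable fun a => if a < v then ENNReal.ofReal (v - a) ^ k else 0 := fun k =>
      Measurable.ite measurableSet_Iio (by fun_prop) measurable_const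
    rw [busyMean, busyRemainder, ← lintegral_const_mul _ hDm,
      ← lintegral_add_right _ (hDm.const_mul _)]
    -- On a < v the induction hypothesis gives a + κ(v - a + E[U]), which is v + κr(v - a) + κE[U]
    -- because κ = 1 + κr.
    calc _ = ∫⁻ a, (ENNReal.ofReal v + (κ * r * (if a < v then ENNReal.ofReal (v - a) ^ 1 else 0) +
            κ * posMoment 1 ν * (if a < v then ENNReal.ofReal (v - a) ^ 0 else 0)))
            ∂expMeasure lam := by
          refine lintegral_congr_ae ?_
          filter_upwards [ae_expMeasure_nonneg] with a ha
          split_ifs with hav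
          · have hz : 0 ≤ v - a := by linarith
            have hGz : Measurable fun u => busyMean lam ν N (v - a + u) :=
              (measurable_busyMean hlam N).comp (measurable_const_add _)
            have hDz : Measurable fun u => busyRemainder lam ν N (v - a + u) :=
              (measurable_busyRemainder hlam N).comp (measurable_const_add _)
            rw [add_assoc, ← lintegral_const_mul _ hDz, ← lintegral_add_left hGz,
              lintegral_congr_ae (hν.mono fun u hu => ih (add_nonneg hz hu)),
              lintegral_const_mul _ (by fun_prop), lintegral_ofReal_add hν hz]
            have hva : ENNReal.ofReal v = ENNReal.ofReal a + ENNReal.ofReal (v - a) := by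
              rw [← ENNReal.ofReal_add ha hz, add_sub_cancel]
            rw [hva, pow_one, pow_zero, mul_one, mul_add]
            nth_rw 1 [hκ]
            ring
          · simp
      _ = ENNReal.ofReal v + (κ * r * expTrunc lam 1 v + κ * posMoment 1 ν * expTrunc lam 0 v) := by
          rw [lintegral_add_left measurable_const, lintegral_add_left ((hI 1).const_mul _),
            lintegral_const_mul _ (hI 1), lintegral_const_mul _ (hI 0)]
          simp [expTrunc]
      _ = ENNReal.ofReal v + κ * r * (expTrunc lam (0 + 1) v
            + ((0 : ℕ) + 1) * ENNReal.ofReal lam⁻¹ * expTrunc lam 0 v) := by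
          rw [hr]
          push_cast
          ring_nf
      _ = κ * ENNReal.ofReal v := by
          rw [expTrunc_succ hlam 0 hv]
          nth_rw 2 [hκ]
          ring

/-- Quadratic Lyapunov function for the busy period. -/
theorem sum_busyRemainder_le [IsProbabilityMeasure ν] (hlam : 0 < lam) (hν : ∀ᵐ u ∂ν, 0 ≤ u)
    {δ b : ℝ≥0∞} (hδ : posMoment 1 ν + δ = ENNReal.ofReal lam⁻¹)
    (hb : b * δ = posMoment 2 ν + 2 * δ * ENNReal.ofReal lam⁻¹) (N : ℕ) {v : ℝ} (hv : 0 ≤ v) :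
    2 * δ * ∑ k ∈ Finset.range N, busyRemainder lam ν k v ≤
      ENNReal.ofReal v ^ 2 + b * ENNReal.ofReal v := by
  induction N generalizing v with
  | zero => simp
  | succ N ih =>
    have hm : ∀ k, Measurable fun z => ∫⁻ u, busyRemainder lam ν k (z + u) ∂ν := fun k =>
      measurable_lintegral_add (measurable_busyRemainder hlam k)
    have hI : ∀ k, Measurable fun a => if a < v then ENNReal.ofReal (v - a) ^ k else 0 := fun k =>
      Measurable.ite measurableSet_Iio (by fun_prop) measurable_const
    have hsum : 2 * δ * ∑ k ∈ Finset.range N, busyRemainder lam ν (k + 1) v ≤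
        expTrunc lam 2 v + ((2 * posMoment 1 ν + b) * expTrunc lam 1 v +
          (posMoment 2 ν + b * posMoment 1 ν) * expTrunc lam 0 v) := by
      calc 2 * δ * ∑ k ∈ Finset.range N, busyRemainder lam ν (k + 1) v
          = ∫⁻ a, (if a < v then
              ∫⁻ u, 2 * δ * ∑ k ∈ Finset.range N, busyRemainder lam ν k (v - a + u) ∂ν else 0)
              ∂expMeasure lam := by
            have hDm : ∀ k, Measurable fun a => if a < v then
                ∫⁻ u, busyRemainder lam ν k (v - a + u) ∂ν else 0 := fun k =>
              Measurable.ite measurableSet_Iio ((hm k).comp (measurable_const.sub measurable_id))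
                measurable_const
            have hDz : ∀ k z, Measurable fun u => busyRemainder lam ν k (z + u) := fun k z =>
              (measurable_busyRemainder hlam k).comp (measurable_const_add z)
            simp only [busyRemainder]
            rw [← lintegral_finsetSum _ fun k _ => hDm k,
              ← lintegral_const_mul _ (Finset.measurable_fun_sum _ fun k _ => hDm k)]
            refine lintegral_congr fun a => ?_
            split_ifs with hav
            · rw [lintegral_const_mul _ (Finset.measurable_fun_sum _ fun k _ => hDz k _),
                lintegral_finsetSum _ fun k _ => hDz k _]
            · simp
        _ ≤ ∫⁻ a, ((if a < v then ENNReal.ofReal (v - a) ^ 2 else 0) +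
            ((2 * posMoment 1 ν + b) * (if a < v then ENNReal.ofReal (v - a) ^ 1 else 0) +
            (posMoment 2 ν + b * posMoment 1 ν) *
              (if a < v then ENNReal.ofReal (v - a) ^ 0 else 0))) ∂expMeasure lam := by
            refine lintegral_mono fun a => ?_
            split_ifs with hav
            · have hz : 0 ≤ v - a := by linarith
              calc ∫⁻ u, 2 * δ * ∑ k ∈ Finset.range N, busyRemainder lam ν k (v - a + u) ∂ν
                  ≤ ∫⁻ u, ((ENNReal.ofReal (v - a) + ENNReal.ofReal u) ^ 2 +
                      b * (ENNReal.ofReal (v - a) + ENNReal.ofReal u)) ∂ν := by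
                    refine lintegral_mono_ae (hν.mono fun u hu => ?_)
                    rw [← ENNReal.ofReal_add hz hu]
                    exact ih (add_nonneg hz hu)
                _ = ∫⁻ u, ((ENNReal.ofReal (v - a) ^ 2 + b * ENNReal.ofReal (v - a)) +
                      (2 * ENNReal.ofReal (v - a) + b) * ENNReal.ofReal u ^ 1 +
                      ENNReal.ofReal u ^ 2) ∂ν := lintegral_congr fun u => by ring
                _ = _ := by
                    rw [lintegral_add_left (by fun_prop), lintegral_add_left (by fun_prop),
                      lintegral_const_mul _ (by fun_prop), lintegral_const, measure_univ]
                    change _ + _ * posMoment 1 ν + posMoment 2 ν = _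
                    ring
            · simp
        _ = _ := by
            rw [lintegral_add_left (hI 2), lintegral_add_left ((hI 1).const_mul _),
              lintegral_const_mul _ (hI 1), lintegral_const_mul _ (hI 0)]
            rfl
    have h1 := expTrunc_succ hlam 1 hv
    have h0 := expTrunc_succ hlam 0 hv
    norm_num at h1 h0
    rw [Finset.sum_range_succ', mul_add]
    -- Writing v as a combination of `expTrunc` of orders 1 and 0 completes the order-2 identity.
    -- The choice of `b` makes the coefficient of order 0 equal to b(δ + E[U]) = b/λ, so the linear
    -- part closes up to b v.
    calc 2 * δ * ∑ k ∈ Finset.range N, busyRemainder lam ν (k + 1) v +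
          2 * δ * busyRemainder lam ν 0 v
        ≤ expTrunc lam 2 v + ((2 * posMoment 1 ν + b) * expTrunc lam 1 v +
          (posMoment 2 ν + b * posMoment 1 ν) * expTrunc lam 0 v) +
          2 * δ * (expTrunc lam 1 v + ENNReal.ofReal lam⁻¹ * expTrunc lam 0 v) := by
          rw [h0, busyRemainder]
          gcongr
      _ = (expTrunc lam 2 v + 2 * (posMoment 1 ν + δ) * expTrunc lam 1 v) + b * expTrunc lam 1 v +
          ((posMoment 2 ν + 2 * δ * ENNReal.ofReal lam⁻¹) + b * posMoment 1 ν)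
            * expTrunc lam 0 v := by ring
      _ = ENNReal.ofReal v ^ 2 + b * (expTrunc lam 1 v +
          (posMoment 1 ν + δ) * expTrunc lam 0 v) := by
          rw [← hb, ← h1, ← hδ]; ring
      _ = _ := by rw [hδ, h0]

/-- The mean length of a busy period is proportional to the initial work. -/
theorem tendsto_busyMean [IsProbabilityMeasure ν] (hlam : 0 < lam) (hν : ∀ᵐ u ∂ν, 0 ≤ u)
    {κ r : ℝ≥0∞} (hr : posMoment 1 ν = r * ENNReal.ofReal lam⁻¹) (hκ : κ = 1 + κ * r)
    (hκt : κ ≠ ⊤) (hr1 : r < 1) (h2 : posMoment 2 ν ≠ ⊤) {v : ℝ} (hv : 0 ≤ v) :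
    Tendsto (fun N => busyMean lam ν N v) atTop (𝓝 (κ * ENNReal.ofReal v)) := by
  set l := ENNReal.ofReal lam⁻¹ with hl
  have hl0 : l ≠ 0 := by simpa [hl] using hlam
  have hlt : l ≠ ⊤ := ENNReal.ofReal_ne_top
  have hstable : posMoment 1 ν < l := by
    rw [hr]
    calc r * l < 1 * l := (ENNReal.mul_lt_mul_iff_left hl0 hlt).2 hr1
      _ = l := one_mul l
  set δ := l - posMoment 1 ν
  have hδ : posMoment 1 ν + δ = l := add_tsub_cancel_of_le hstable.le
  have hδ0 : δ ≠ 0 := (tsub_pos_of_lt hstable).ne'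
  have hδt : δ ≠ ⊤ := ne_top_of_le_ne_top hlt tsub_le_self
  set b := (posMoment 2 ν + 2 * δ * l) / δ with hbdef
  have hb : b * δ = posMoment 2 ν + 2 * δ * l := ENNReal.div_mul_cancel hδ0 hδt
  have hbt : b ≠ ⊤ := ENNReal.div_ne_top (by finiteness) hδ0
  -- The Lyapunov bound is uniform in N, so the remainders are summable and tend to zero.
  have hsum : ∑' k, busyRemainder lam ν k v ≠ ⊤ := by
    have hle : 2 * δ * ∑' k, busyRemainder lam ν k v ≤
        ENNReal.ofReal v ^ 2 + b * ENNReal.ofReal v := by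
      rw [ENNReal.tsum_eq_iSup_nat, ENNReal.mul_iSup]
      exact iSup_le fun N => sum_busyRemainder_le hlam hν hδ hb N hv
    intro htop
    rw [htop, ENNReal.mul_top (by simp [hδ0])] at hle
    exact (ne_top_of_le_ne_top (by finiteness) hle) rfl
  have hD := ENNReal.tendsto_atTop_zero_of_tsum_ne_top hsum
  have hrt : r ≠ ⊤ := ne_top_of_lt hr1
  have hlim : Tendsto (fun N => κ * ENNReal.ofReal v - κ * r * busyRemainder lam ν N v) atTop
      (𝓝 (κ * ENNReal.ofReal v - κ * r * 0)) :=
    ENNReal.Tendsto.sub tendsto_const_nhds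
      (ENNReal.Tendsto.const_mul hD (Or.inr (by finiteness))) (Or.inl (by finiteness))
  rw [mul_zero, tsub_zero] at hlim
  refine hlim.congr fun N => ?_
  have h := busyMean_add_busyRemainder hlam hν hr hκ N hv
  have hfin : κ * r * busyRemainder lam ν N v ≠ ⊤ :=
    ne_top_of_le_ne_top (by finiteness) (h ▸ le_add_self)
  rw [← h, ENNReal.add_sub_cancel_right hfin]

theorem busyMean_le [IsProbabilityMeasure ν] (hlam : 0 < lam) (hν : ∀ᵐ u ∂ν, 0 ≤ u)
    {κ r : ℝ≥0∞} (hr : posMoment 1 ν = r * ENNReal.ofReal lam⁻¹) (hκ : κ = 1 + κ * r) (N : ℕ)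
    {v : ℝ} (hv : 0 ≤ v) : busyMean lam ν N v ≤ κ * ENNReal.ofReal v :=
  le_self_add.trans_eq (busyMean_add_busyRemainder hlam hν hr hκ N hv)

end BusyPeriod

/-! ### Sequences of i.i.d. variables -/

section IID

variable {α β : Type*}

/-- Put an element in front of a sequence. -/
def seqCons (c : α) (ω : ℕ → α) : ℕ → α
  | 0 => c
  | n + 1 => ω n

/-- The sequence without its first `n` terms. -/
def seqShift (n : ℕ) (ω : ℕ → α) : ℕ → α := fun k => ω (n + k)

/-- State after `n` steps of a recursion driven by a sequence. -/
def stateAfter (step : β → α → β) (s : β) (ω : ℕ → α) : ℕ → β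
  | 0 => s
  | n + 1 => step (stateAfter step s ω n) (ω n)

theorem stateAfter_seqCons (step : β → α → β) (s : β) (c : α) (ω : ℕ → α) (n : ℕ) :
    stateAfter step s (seqCons c ω) (n + 1) = stateAfter step (step s c) ω n := by
  induction n with
  | zero => rfl
  | succ n ih => rw [stateAfter, ih]; rfl

variable [MeasurableSpace α]

theorem measurable_seqCons : Measurable fun p : α × (ℕ → α) => seqCons p.1 p.2 :=
  measurable_pi_lambda _ fun n => by
    cases n with
    | zero => exact measurable_fst
    | succ n => exact (measurable_pi_apply n).comp measurable_snd

theorem measurable_seqShift (n : ℕ) : Measurable (seqShift n : (ℕ → α) → ℕ → α) :=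
  measurable_pi_lambda _ fun _ => measurable_pi_apply _

theorem measurable_stateAfter [MeasurableSpace β] {step : β → α → β}
    (hstep : Measurable fun p : β × α => step p.1 p.2)
    (n : ℕ) : Measurable fun p : β × (ℕ → α) => stateAfter step p.1 p.2 n := by
  induction n with
  | zero => exact measurable_fst
  | succ n ih => exact hstep.comp (ih.prodMk ((measurable_pi_apply n).comp measurable_snd))

theorem map_seqCons_infinitePi (m : Measure α) [IsProbabilityMeasure m] :
    (m.prod (Measure.infinitePi fun _ : ℕ => m)).map (fun p => seqCons p.1 p.2) =
      Measure.infinitePi fun _ : ℕ => m := by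
  classical
  refine Measure.eq_infinitePi _ fun s t ht => ?_
  rw [Measure.map_apply measurable_seqCons (MeasurableSet.pi s.countable_toSet fun i _ => ht i)]
  -- Padding by the whole space turns the cylinder over `s` into one over an initial segment, where
  -- splitting off coordinate 0 is a plain product.
  set t' : ℕ → Set α := fun i => if i ∈ s then t i else Set.univ with ht'
  have ht'm : ∀ i, MeasurableSet (t' i) := fun i => by
    simp only [ht']; split_ifs; exacts [ht i, MeasurableSet.univ]
  obtain ⟨N, hN⟩ : ∃ N, s ⊆ Finset.range (N + 1) :=
    ⟨s.sup id, fun i hi => Finset.mem_range.2 (Nat.lt_succ_of_le (Finset.le_sup (f := id) hi))⟩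
  have hset : (fun p : α × (ℕ → α) => seqCons p.1 p.2) ⁻¹' (s : Set ℕ).pi t =
      t' 0 ×ˢ (Finset.range N : Set ℕ).pi fun i => t' (i + 1) := by
    ext ⟨c, ω⟩
    simp only [Set.mem_preimage, Set.mem_pi, Finset.mem_coe, Set.mem_prod, ht', Finset.mem_range]
    constructor
    · intro h
      refine ⟨?_, fun i _ => ?_⟩
      · split_ifs with h0
        · exact h 0 h0
        · trivial
      · split_ifs with h0
        · exact h (i + 1) h0
        · trivial
    · rintro ⟨h0, h1⟩ i hi
      cases i with
      | zero => simpa [hi, seqCons] using h0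
      | succ i =>
        have := h1 i (by simpa using hN hi)
        simpa [hi, seqCons] using this
  rw [hset, Measure.prod_prod, Measure.infinitePi_pi _ fun i _ => ht'm (i + 1), mul_comm,
    ← Finset.prod_range_succ' (fun i => m (t' i)), ← Finset.prod_subset hN]
  · exact Finset.prod_congr rfl fun i hi => by simp [ht', hi]
  · intro i _ hi
    simp [ht', hi]

theorem lintegral_infinitePi_seqCons (m : Measure α) [IsProbabilityMeasure m]
    {F : (ℕ → α) → ℝ≥0∞} (hF : Measurable F) :
    ∫⁻ ω, F ω ∂(Measure.infinitePi fun _ : ℕ => m) =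
      ∫⁻ c, ∫⁻ ω, F (seqCons c ω) ∂(Measure.infinitePi fun _ : ℕ => m) ∂m := by
  conv_lhs => rw [← map_seqCons_infinitePi m]
  rw [lintegral_map hF measurable_seqCons]
  exact lintegral_prod _ (hF.comp measurable_seqCons).aemeasurable

theorem lintegral_infinitePi_eval_zero (m : Measure α) [IsProbabilityMeasure m]
    {f : α → ℝ≥0∞} (hf : Measurable f) :
    ∫⁻ ω, f (ω 0) ∂(Measure.infinitePi fun _ : ℕ => m) = ∫⁻ c, f c ∂m :=
  (measurePreserving_eval_infinitePi (fun _ : ℕ => m) 0).lintegral_comp hf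

/-- The future of an i.i.d. sequence is independent of the state reached. -/
theorem lintegral_stateAfter_seqShift [MeasurableSpace β] (m : Measure α) [IsProbabilityMeasure m]
    {step : β → α → β}
    (hstep : Measurable fun p : β × α => step p.1 p.2) {F : β → (ℕ → α) → ℝ≥0∞}
    (hF : Measurable fun p : β × (ℕ → α) => F p.1 p.2) (n : ℕ) (s : β) :
    ∫⁻ ω, F (stateAfter step s ω n) (seqShift n ω) ∂(Measure.infinitePi fun _ : ℕ => m) =
      ∫⁻ ω, ∫⁻ ω', F (stateAfter step s ω n) ω' ∂(Measure.infinitePi fun _ : ℕ => m)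
        ∂(Measure.infinitePi fun _ : ℕ => m) := by
  have hG : Measurable fun x => ∫⁻ ω', F x ω' ∂(Measure.infinitePi fun _ : ℕ => m) :=
    hF.lintegral_prod_right'
  have hst : ∀ n s, Measurable fun ω : ℕ → α => stateAfter step s ω n := fun n s =>
    (measurable_stateAfter hstep n).comp (measurable_const.prodMk measurable_id)
  induction n generalizing s with
  | zero =>
    have h : ∀ ω : ℕ → α, seqShift 0 ω = ω := fun ω => funext fun k => by simp [seqShift]
    simp [stateAfter, h]
  | succ n ih =>
    have hFn : Measurable fun ω => F (stateAfter step s ω (n + 1)) (seqShift (n + 1) ω) :=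
      hF.comp ((hst (n + 1) s).prodMk (measurable_seqShift (n + 1)))
    rw [lintegral_infinitePi_seqCons m hFn,
      lintegral_infinitePi_seqCons m (F := fun ω => ∫⁻ ω', F (stateAfter step s ω (n + 1)) ω'
        ∂(Measure.infinitePi fun _ : ℕ => m)) (hG.comp (hst _ _))]
    refine lintegral_congr fun c => ?_
    have h : ∀ ω : ℕ → α, seqShift (n + 1) (seqCons c ω) = seqShift n ω := fun ω =>
      funext fun k => by simp only [seqShift, Nat.add_right_comm n 1 k]; rfl
    simp only [stateAfter_seqCons, h]
    -- Splitting off the first term only changes the starting state, hence the induction over all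
    -- states.
    exact ih _

end IID

/-! ### Busy periods along a sample path -/

namespace MG1Queue

/-- Length of the busy period of premium work with initial work `v`, when only the first `N` later
arrivals count. -/
noncomputable def busyLength : ℕ → ℝ → (ℕ → Customer) → ℝ≥0∞
  | 0, v, _ => ENNReal.ofReal v
  | N + 1, v, ω => if (ω 0).gap < v then
      ENNReal.ofReal (ω 0).gap +
        busyLength N (v - (ω 0).gap + (ω 1).premiumReq) (seqShift 1 ω)
      else ENNReal.ofReal v

/-- The contribution of the first `N` later arrivals to the later premium work. -/
noncomputable def laterPremiumWorkTrunc (ω : ℕ → Customer) (N : ℕ) (t : ℝ≥0∞) : ℝ≥0∞ :=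
  ∑ k ∈ Finset.range N, if ENNReal.ofReal (elapsed ω 0 (k + 1)) < t
    then ENNReal.ofReal (ω (0 + (k + 1))).premiumReq else 0

/-- All requirements and gaps are non-negative. -/
def IsRegular (ω : ℕ → Customer) : Prop := ∀ n, 0 ≤ (ω n).req ∧ 0 ≤ (ω n).gap

theorem _root_.Customer.premiumReq_nonneg {c : Customer} (hc : 0 ≤ c.req) : 0 ≤ c.premiumReq := by
  unfold Customer.premiumReq; split_ifs <;> simp [hc]

theorem _root_.Customer.ordinaryReq_nonneg {c : Customer} (hc : 0 ≤ c.req) :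
    0 ≤ c.ordinaryReq := by
  unfold Customer.ordinaryReq; split_ifs <;> simp [hc]

theorem _root_.Customer.premiumReq_add_ordinaryReq (c : Customer) :
    c.premiumReq + c.ordinaryReq = c.req := by
  unfold Customer.premiumReq Customer.ordinaryReq; split_ifs <;> simp

variable {ω : ℕ → Customer}

theorem IsRegular.seqShift (h : IsRegular ω) (n : ℕ) : IsRegular (seqShift n ω) :=
  fun k => h (n + k)

theorem IsRegular.elapsed_nonneg (h : IsRegular ω) (n k : ℕ) : 0 ≤ elapsed ω n k :=
  Finset.sum_nonneg fun _ _ => (h _).2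

theorem elapsed_seqShift (n m k : ℕ) : elapsed (seqShift n ω) m k = elapsed ω (n + m) k := by
  simp only [elapsed, seqShift, add_assoc]

theorem elapsed_succ (k : ℕ) : elapsed ω 0 (k + 1) = (ω 0).gap + elapsed (seqShift 1 ω) 0 k := by
  simp only [elapsed, seqShift, Finset.sum_range_succ']
  rw [add_comm]
  simp [add_comm]

theorem laterPremiumWork_seqShift (n : ℕ) (t : ℝ≥0∞) :
    laterPremiumWork (seqShift n ω) 0 t = laterPremiumWork ω n t := by
  simp only [laterPremiumWork, elapsed_seqShift, seqShift, zero_add, add_zero]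

theorem laterPremiumWork_eq_iSup (t : ℝ≥0∞) :
    laterPremiumWork ω 0 t = ⨆ N, laterPremiumWorkTrunc ω N t :=
  ENNReal.tsum_eq_iSup_nat

theorem laterPremiumWorkTrunc_le (N : ℕ) (t : ℝ≥0∞) :
    laterPremiumWorkTrunc ω N t ≤ laterPremiumWork ω 0 t := by
  rw [laterPremiumWork_eq_iSup]
  exact le_iSup (fun N => laterPremiumWorkTrunc ω N t) N

theorem laterPremiumWorkTrunc_mono {M N : ℕ} (hMN : M ≤ N) {s t : ℝ≥0∞} (hst : s ≤ t) :
    laterPremiumWorkTrunc ω M s ≤ laterPremiumWorkTrunc ω N t := by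
  refine (Finset.sum_le_sum fun k _ => ?_).trans
    (Finset.sum_le_sum_of_subset (Finset.range_mono hMN))
  split_ifs with h1 h2
  · exact le_rfl
  · exact absurd (h1.trans_le hst) h2
  · exact zero_le
  · exact le_rfl

/-- Decomposition of the later work at the first arrival. -/
theorem laterPremiumWorkTrunc_succ (h : IsRegular ω) (N : ℕ) {t : ℝ≥0∞} :
    laterPremiumWorkTrunc ω (N + 1) (ENNReal.ofReal (ω 0).gap + t) =
      laterPremiumWorkTrunc (seqShift 1 ω) N t +
        if 0 < t then ENNReal.ofReal (ω 1).premiumReq else 0 := by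
  have ha : ENNReal.ofReal (ω 0).gap ≠ ⊤ := ENNReal.ofReal_ne_top
  rw [laterPremiumWorkTrunc, Finset.sum_range_succ', laterPremiumWorkTrunc]
  congr 1
  · refine Finset.sum_congr rfl fun k _ => ?_
    simp only [elapsed_succ (k + 1), ENNReal.ofReal_add (h 0).2
      ((h.seqShift 1).elapsed_nonneg 0 (k + 1)), ENNReal.add_lt_add_iff_left ha]
    simp only [seqShift, zero_add, add_comm 1]
  · rw [elapsed_succ]
    simp only [elapsed, Finset.range_zero, Finset.sum_empty, add_zero, zero_add]
    have : ENNReal.ofReal (ω 0).gap < ENNReal.ofReal (ω 0).gap + t ↔ 0 < t := by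
      conv_lhs => lhs; rw [← add_zero (ENNReal.ofReal (ω 0).gap)]
      exact ENNReal.add_lt_add_iff_left ha
    simp only [this]

/-- Half of the minimality of the busy period: every time by which the server can have finished
bounds each truncated length. Passing to truncated later work gives a hypothesis that survives the
shift in the induction. -/
theorem busyLength_le (h : IsRegular ω) (N : ℕ) {v : ℝ} {t : ℝ≥0∞}
    (ht : ENNReal.ofReal v + laterPremiumWork ω 0 t ≤ t) : busyLength N v ω ≤ t := by
  suffices H : ∀ N (ω : ℕ → Customer) (v : ℝ) (t : ℝ≥0∞), IsRegular ω →
      ENNReal.ofReal v + laterPremiumWorkTrunc ω N t ≤ t → busyLength N v ω ≤ t from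
    H N ω v t h ((add_le_add_right (laterPremiumWorkTrunc_le N t) _).trans ht)
  clear! ω v t N
  intro N
  induction N with
  | zero => intro ω v t _ ht; exact le_self_add.trans ht
  | succ N ih =>
    intro ω v t h ht
    rw [busyLength]
    split_ifs with hav
    -- Since t ≥ v exceeds the first gap, write t = gap + r; then r solves the same inequality for
    -- the shifted path.
    · have hat : ENNReal.ofReal (ω 0).gap < t :=
        ((ENNReal.ofReal_lt_ofReal_iff ((h 0).2.trans_lt hav)).2 hav).trans_le
          (le_self_add.trans ht)
      obtain ⟨r, rfl⟩ := exists_add_of_le hat.le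
      have hr : 0 < r := by
        rcases eq_or_ne r 0 with rfl | hr
        · simp at hat
        · exact pos_iff_ne_zero.2 hr
      rw [laterPremiumWorkTrunc_succ h, if_pos hr] at ht
      refine add_le_add_right (ih _ _ _ (h.seqShift 1) ?_) _
      refine (ENNReal.add_le_add_iff_left (ENNReal.ofReal_ne_top (r := (ω 0).gap))).1 ?_
      refine le_trans (le_of_eq ?_) ht
      rw [ENNReal.ofReal_add (by linarith) (Customer.premiumReq_nonneg (h 1).1)]
      have hva : ENNReal.ofReal v = ENNReal.ofReal (ω 0).gap + ENNReal.ofReal (v - (ω 0).gap) := by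
        rw [← ENNReal.ofReal_add (h 0).2 (by linarith), add_sub_cancel]
      rw [hva]
      ring
    · exact le_self_add.trans ht

/-- The other half: the truncated busy length itself satisfies the truncated inequality. -/
theorem add_laterPremiumWorkTrunc_busyLength_le (h : IsRegular ω) (N : ℕ) (v : ℝ) :
    ENNReal.ofReal v + laterPremiumWorkTrunc ω N (busyLength N v ω) ≤ busyLength N v ω := by
  induction N generalizing ω v with
  | zero => simp [laterPremiumWorkTrunc, busyLength]
  | succ N ih =>
    rw [busyLength]
    split_ifs with hav
    · have hva : ENNReal.ofReal v = ENNReal.ofReal (ω 0).gap + ENNReal.ofReal (v - (ω 0).gap) := by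
        rw [← ENNReal.ofReal_add (h 0).2 (by linarith), add_sub_cancel]
      rw [laterPremiumWorkTrunc_succ h]
      have hih := ih (h.seqShift 1) (v - (ω 0).gap + (ω 1).premiumReq)
      set B := busyLength N (v - (ω 0).gap + (ω 1).premiumReq) (seqShift 1 ω)
      rw [ENNReal.ofReal_add (by linarith) (Customer.premiumReq_nonneg (h 1).1)] at hih
      calc ENNReal.ofReal v + (laterPremiumWorkTrunc (seqShift 1 ω) N B +
            if 0 < B then ENNReal.ofReal (ω 1).premiumReq else 0)
          ≤ ENNReal.ofReal v + (laterPremiumWorkTrunc (seqShift 1 ω) N B +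
            ENNReal.ofReal (ω 1).premiumReq) := by
            gcongr; split_ifs <;> simp
        _ = ENNReal.ofReal (ω 0).gap + (ENNReal.ofReal (v - (ω 0).gap) +
            ENNReal.ofReal (ω 1).premiumReq + laterPremiumWorkTrunc (seqShift 1 ω) N B) := by
            rw [hva]; ring
        _ ≤ _ := by gcongr
    · have h0 : laterPremiumWorkTrunc ω (N + 1) (ENNReal.ofReal v) = 0 := by
        refine Finset.sum_eq_zero fun k _ => if_neg (not_lt.2 (ENNReal.ofReal_le_ofReal ?_))
        rw [elapsed_succ]
        linarith [(h.seqShift 1).elapsed_nonneg 0 k]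
      rw [h0, add_zero]

theorem monotone_busyLength (h : IsRegular ω) (v : ℝ) : Monotone fun N => busyLength N v ω := by
  refine monotone_nat_of_le_succ fun N => ?_
  induction N generalizing ω v with
  | zero =>
    rw [busyLength, busyLength]
    split_ifs with hav
    · rw [busyLength, ← ENNReal.ofReal_add (h 0).2 (by
        linarith [Customer.premiumReq_nonneg (h 1).1])]
      exact ENNReal.ofReal_le_ofReal (by linarith [Customer.premiumReq_nonneg (h 1).1])
    · exact le_rfl
  | succ N ih =>
    rw [busyLength, busyLength]
    split_ifs with hav
    · exact add_le_add_right (ih (h.seqShift 1) _) _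
    · exact le_rfl

theorem sInf_busy_eq_iSup (h : IsRegular ω) (v : ℝ) :
    sInf {t : ℝ≥0∞ | ENNReal.ofReal v + laterPremiumWork ω 0 t ≤ t} = ⨆ N, busyLength N v ω := by
  refine le_antisymm (sInf_le ?_) (iSup_le fun N => le_sInf fun t ht => busyLength_le h N ht)
  set s := ⨆ N, busyLength N v ω with hs
  rw [Set.mem_ofPred_eq, laterPremiumWork_eq_iSup, ENNReal.add_iSup]
  refine iSup_le fun M => ?_
  have hlim : Tendsto (fun N => busyLength N v ω) atTop (𝓝 s) :=
    tendsto_atTop_iSup (monotone_busyLength h v)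
  -- Later work counts arrivals strictly before t, hence is left-continuous in t: finitely many
  -- arrivals before the supremum are already before some `busyLength N`.
  have hev : ∀ᶠ N in atTop, ∀ k ∈ Finset.range M, ENNReal.ofReal (elapsed ω 0 (k + 1)) < s →
      ENNReal.ofReal (elapsed ω 0 (k + 1)) < busyLength N v ω := by
    rw [eventually_all_finset]
    intro k _
    by_cases hk : ENNReal.ofReal (elapsed ω 0 (k + 1)) < s
    · exact (hlim.eventually_const_lt hk).mono fun N hN _ => hN
    · exact Eventually.of_forall fun N hN => absurd hN hk
  obtain ⟨N, hN, hMN⟩ := (hev.and (eventually_ge_atTop M)).exists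
  have h1 : laterPremiumWorkTrunc ω M s ≤ laterPremiumWorkTrunc ω M (busyLength N v ω) := by
    refine Finset.sum_le_sum fun k hk => ?_
    split_ifs with h1 h2
    · exact le_rfl
    · exact absurd (hN k hk h1) h2
    · exact zero_le
    · exact le_rfl
  calc ENNReal.ofReal v + laterPremiumWorkTrunc ω M s
      ≤ ENNReal.ofReal v + laterPremiumWorkTrunc ω N (busyLength N v ω) := by
        gcongr
        exact h1.trans (laterPremiumWorkTrunc_mono hMN le_rfl)
    _ ≤ busyLength N v ω := add_laterPremiumWorkTrunc_busyLength_le h N v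
    _ ≤ s := le_iSup (fun N => busyLength N v ω) N

theorem ordinarySojourn_eq_iSup (h : IsRegular ω) (n : ℕ) :
    ordinarySojourn ω n =
      ⨆ N, busyLength N ((workFound ω n).1 + (workFound ω n).2 + (ω n).req) (seqShift n ω) := by
  rw [← sInf_busy_eq_iSup (h.seqShift n), ordinarySojourn]
  simp only [laterPremiumWork_seqShift]

end MG1Queue

theorem lintegral_bernoulliMeasure {X : Type*} [MeasurableSpace X] [MeasurableSingletonClass X]
    (x y : X) (φ : I) (f : X → ℝ≥0∞) :
    ∫⁻ b, f b ∂bernoulliMeasure x y φ =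
      ENNReal.ofReal φ * f x + ENNReal.ofReal (1 - φ) * f y := by
  rw [bernoulliMeasure_def]
  simp only [lintegral_add_measure, lintegral_smul_measure, lintegral_dirac]
  rw [ENNReal.ofReal_eq_coe_nnreal φ.2.1, ENNReal.ofReal_eq_coe_nnreal (sub_nonneg.2 φ.2.2)]
  rfl

namespace MG1Queue

/-! ### The work found by a customer -/

variable (Q : MG1Queue)

/-- Law of the data of one customer. -/
noncomputable def customerLaw (φ : I) : Measure Customer :=
  (bernoulliMeasure true false φ).prod (Q.service.prod (expMeasure Q.lam))

theorem law_eq (φ : I) : Q.law φ = Measure.infinitePi fun _ : ℕ => Q.customerLaw φ := rfl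

instance : IsProbabilityMeasure Q.service := Q.isProb

instance : IsProbabilityMeasure (expMeasure Q.lam) := isProbabilityMeasure_expMeasure Q.lam_pos

instance (φ : I) : IsProbabilityMeasure (Q.customerLaw φ) := by
  unfold customerLaw; infer_instance

instance (φ : I) : IsProbabilityMeasure (Q.law φ) := by
  rw [law_eq]; infer_instance

/-- Law of a work `e` that depends on the class and the requirement of a customer. -/
noncomputable def workLaw (φ : I) (e : Bool × ℝ → ℝ) : Measure ℝ :=
  (Q.customerLaw φ).map fun c => e (c.1, c.2.1)

theorem isProbabilityMeasure_workLaw (φ : I) {e : Bool × ℝ → ℝ} (he : Measurable e) :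
    IsProbabilityMeasure (Q.workLaw φ e) :=
  Measure.isProbabilityMeasure_map (by fun_prop)

theorem lintegral_workLaw (φ : I) {e : Bool × ℝ → ℝ} (he : Measurable e) {f : ℝ → ℝ≥0∞}
    (hf : Measurable f) :
    ∫⁻ u, f u ∂Q.workLaw φ e =
      ∫⁻ b, ∫⁻ s, f (e (b, s)) ∂Q.service ∂bernoulliMeasure true false φ := by
  rw [workLaw, lintegral_map hf (by fun_prop), customerLaw, lintegral_prod _ (by fun_prop)]
  refine lintegral_congr fun b => ?_
  rw [lintegral_prod _ (by fun_prop)]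
  simp

theorem lintegral_customerLaw (φ : I) {e : Bool × ℝ → ℝ} (he : Measurable e) {F : ℝ → ℝ → ℝ≥0∞}
    (hF : Measurable fun p : ℝ × ℝ => F p.1 p.2) :
    ∫⁻ c, F (e (c.1, c.2.1)) c.gap ∂Q.customerLaw φ =
      ∫⁻ u, ∫⁻ a, F u a ∂expMeasure Q.lam ∂Q.workLaw φ e := by
  have h1 : Measurable fun c : Bool × ℝ × ℝ => F (e (c.1, c.2.1)) c.2.2 :=
    hF.comp (by fun_prop : Measurable fun c : Bool × ℝ × ℝ => (e (c.1, c.2.1), c.2.2))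
  rw [Q.lintegral_workLaw φ he (f := fun u => ∫⁻ a, F u a ∂expMeasure Q.lam)
    hF.lintegral_prod_right', customerLaw]
  refine (lintegral_prod _ h1.aemeasurable).trans (lintegral_congr fun b => ?_)
  exact lintegral_prod _ (h1.comp measurable_prodMk_left).aemeasurable

theorem ae_customerLaw_regular (φ : I) :
    ∀ᵐ c ∂Q.customerLaw φ, 0 ≤ c.req ∧ 0 ≤ c.gap := by
  refine Measure.quasiMeasurePreserving_snd.ae (p := fun x : ℝ × ℝ => 0 ≤ x.1 ∧ 0 ≤ x.2) ?_
  exact (Measure.quasiMeasurePreserving_fst.ae Q.service_nonneg).and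
    (Measure.quasiMeasurePreserving_snd.ae ae_expMeasure_nonneg)

theorem ae_law_isRegular (φ : I) : ∀ᵐ ω ∂Q.law φ, IsRegular ω :=
  ae_all_iff.2 fun n =>
    (measurePreserving_eval_infinitePi (fun _ : ℕ => Q.customerLaw φ) n).quasiMeasurePreserving.ae
      (Q.ae_customerLaw_regular φ)

/-- One step of the recursion for the work found. -/
noncomputable def workStep (s : ℝ × ℝ) (c : Customer) : ℝ × ℝ :=
  (max (s.1 + c.premiumReq - c.gap) 0,
    max (s.2 + c.ordinaryReq - max (c.gap - (s.1 + c.premiumReq)) 0) 0)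

theorem workFound_eq_stateAfter (ω : ℕ → Customer) (n : ℕ) :
    workFound ω n = stateAfter workStep (0, 0) ω n := by
  induction n with
  | zero => rfl
  | succ n ih => rw [workFound, stateAfter, ← ih]; rfl

/-- Premium work as a function of class and requirement. -/
noncomputable def premiumPart (x : Bool × ℝ) : ℝ := if x.1 = true then x.2 else 0

theorem measurable_premiumPart : Measurable premiumPart :=
  Measurable.ite (measurable_fst (measurableSet_singleton true)) measurable_snd measurable_const

theorem measurable_premiumReq : Measurable Customer.premiumReq :=
  measurable_premiumPart.comp (by fun_prop : Measurable fun c : Customer => (c.1, c.2.1))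

theorem measurable_ordinaryReq : Measurable Customer.ordinaryReq :=
  Measurable.ite (measurable_fst (measurableSet_singleton true)) measurable_const
    (measurable_fst.comp measurable_snd)

theorem measurable_req : Measurable Customer.req := measurable_fst.comp measurable_snd

theorem measurable_gap : Measurable Customer.gap := measurable_snd.comp measurable_snd

theorem measurable_workStep : Measurable fun p : (ℝ × ℝ) × Customer => workStep p.1 p.2 := by
  have h1 := measurable_premiumReq
  have h2 := measurable_ordinaryReq
  have h3 := measurable_gap
  unfold workStep
  fun_prop

theorem measurable_workFound (n : ℕ) : Measurable fun ω => workFound ω n := by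
  simp_rw [workFound_eq_stateAfter]
  exact (measurable_stateAfter measurable_workStep n).comp (measurable_const.prodMk measurable_id)

theorem workFound_nonneg (ω : ℕ → Customer) (n : ℕ) :
    0 ≤ (workFound ω n).1 ∧ 0 ≤ (workFound ω n).2 := by
  cases n with
  | zero => exact ⟨le_rfl, le_rfl⟩
  | succ n => exact ⟨le_max_right _ _, le_max_right _ _⟩

/-- A component `h` of the work found that follows a Lindley recursion has the law of the
latter. -/
theorem lintegral_workFound (φ : I) {e : Bool × ℝ → ℝ} (he : Measurable e) {h : ℝ × ℝ → ℝ}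
    (hh : Measurable h) (h0 : h (0, 0) = 0)
    (hstep : ∀ (s : ℝ × ℝ) (c : Customer), 0 ≤ s.1 → 0 ≤ s.2 → 0 ≤ c.req →
      h (workStep s c) = max (h s + e (c.1, c.2.1) - c.gap) 0) (n : ℕ)
    {g : ℝ → ℝ≥0∞} (hg : Monotone g) :
    ∫⁻ ω, g (h (workFound ω n)) ∂Q.law φ = ∫⁻ w, g w ∂lindleyLaw Q.lam (Q.workLaw φ e) n := by
  have := Q.isProbabilityMeasure_workLaw φ he
  induction n generalizing g with
  | zero => simp [workFound, h0, lindleyLaw, lintegral_dirac' _ hg.measurable]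
  | succ n ih =>
    have hF : Measurable fun p : (ℝ × ℝ) × (ℕ → Customer) => g (h (workStep p.1 (p.2 0))) :=
      hg.measurable.comp (hh.comp (measurable_workStep.comp
        (measurable_fst.prodMk ((measurable_pi_apply 0).comp measurable_snd))))
    rw [lintegral_lindleyLaw_succ Q.lam_pos n hg.measurable, ← ih hg.lindleyStep]
    calc ∫⁻ ω, g (h (workFound ω (n + 1))) ∂Q.law φ
        = ∫⁻ ω, (fun s ω' => g (h (workStep s (ω' 0)))) (stateAfter workStep (0, 0) ω n)
            (seqShift n ω) ∂Q.law φ := by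
          refine lintegral_congr fun ω => ?_
          rw [workFound_eq_stateAfter]; rfl
      _ = ∫⁻ ω, ∫⁻ ω', g (h (workStep (stateAfter workStep (0, 0) ω n) (ω' 0))) ∂Q.law φ
            ∂Q.law φ :=
          lintegral_stateAfter_seqShift (Q.customerLaw φ) measurable_workStep
            (F := fun s ω' => g (h (workStep s (ω' 0)))) hF n (0, 0)
      _ = _ := by
          refine lintegral_congr fun ω => ?_
          rw [← workFound_eq_stateAfter]
          obtain ⟨hx, hy⟩ := workFound_nonneg ω n
          set s := workFound ω n
          rw [law_eq, lintegral_infinitePi_eval_zero (Q.customerLaw φ)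
            (f := fun c => g (h (workStep s c)))
            (hg.measurable.comp (hh.comp (measurable_workStep.comp
              (measurable_const.prodMk measurable_id))))]
          rw [lintegral_congr_ae ((Q.ae_customerLaw_regular φ).mono fun c hc => by
            rw [hstep s c hx hy hc.1])]
          exact Q.lintegral_customerLaw φ he (F := fun u a => g (max (h s + u - a) 0))
            (hg.measurable.comp (by fun_prop))

/-- Law of the premium work brought by a customer. -/
noncomputable abbrev premiumLaw (φ : I) : Measure ℝ := Q.workLaw φ premiumPart

theorem workLaw_snd (φ : I) : Q.workLaw φ Prod.snd = Q.service := by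
  have : Q.workLaw φ Prod.snd = ((Q.customerLaw φ).map Prod.snd).map Prod.fst :=
    (Measure.map_map measurable_fst measurable_snd).symm
  rw [this, customerLaw, Measure.map_snd_prod, measure_univ, one_smul, Measure.map_fst_prod,
    measure_univ, one_smul]

/-- Preemption makes the premium work autonomous: its recursion never reads the ordinary work. -/
theorem meanPremiumWait_eq (φ : I) (n : ℕ) :
    Q.meanPremiumWait φ n = posMoment 1 (lindleyLaw Q.lam (Q.premiumLaw φ) n) := by
  simp only [posMoment, pow_one]
  exact Q.lintegral_workFound φ measurable_premiumPart measurable_fst rfl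
    (fun s c _ _ _ => rfl) n fun _ _ => ENNReal.ofReal_le_ofReal

/-- Work conservation: the server is busy whenever any work is present, so the total does not depend
on φ. -/
theorem lintegral_totalWork (φ : I) (n : ℕ) :
    ∫⁻ ω, ENNReal.ofReal ((workFound ω n).1 + (workFound ω n).2) ∂Q.law φ =
      posMoment 1 (lindleyLaw Q.lam Q.service n) := by
  simp only [posMoment, pow_one]
  rw [← Q.workLaw_snd φ]
  refine Q.lintegral_workFound φ measurable_snd (h := fun s => s.1 + s.2) (by fun_prop)
    (add_zero 0) (fun s c h1 h2 hc => ?_) n fun _ _ => ENNReal.ofReal_le_ofReal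
  have hp := Customer.premiumReq_nonneg hc
  have ho := Customer.ordinaryReq_nonneg hc
  have hpo := c.premiumReq_add_ordinaryReq
  change max (s.1 + c.premiumReq - c.gap) 0 +
    max (s.2 + c.ordinaryReq - max (c.gap - (s.1 + c.premiumReq)) 0) 0 =
    max (s.1 + s.2 + c.req - c.gap) 0
  -- Either the gap ends before the premium work does and ordinary work is untouched, or the rest of
  -- the gap goes to ordinary work.
  rcases le_total c.gap (s.1 + c.premiumReq) with h | h
  · rw [max_eq_left (by linarith), max_eq_right (a := c.gap - _) (by linarith),
      max_eq_left (by linarith), max_eq_left (by linarith)]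
    linarith
  · rw [max_eq_right (by linarith), max_eq_left (a := c.gap - _) (by linarith), zero_add]
    congr 1
    linarith

/-! ### The sojourn time of an ordinary customer -/

theorem measurable_busyLength (N : ℕ) :
    Measurable fun p : ℝ × (ℕ → Customer) => busyLength N p.1 p.2 := by
  have hgap : Measurable fun p : ℝ × (ℕ → Customer) => (p.2 0).gap :=
    measurable_gap.comp ((measurable_pi_apply 0).comp measurable_snd)
  have hreq : Measurable fun p : ℝ × (ℕ → Customer) => (p.2 1).premiumReq :=
    measurable_premiumReq.comp ((measurable_pi_apply 1).comp measurable_snd)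
  induction N with
  | zero => exact ENNReal.measurable_ofReal.comp measurable_fst
  | succ N ih =>
    refine Measurable.ite (measurableSet_lt hgap measurable_fst) ?_ (by fun_prop)
    exact hgap.ennreal_ofReal.add (ih.comp (((measurable_fst.sub hgap).add hreq).prodMk
      ((measurable_seqShift 1).comp measurable_snd)))

/-- A general `e` is needed because the first customer contributes the full requirement, whereas
every later one contributes only premium work; the induction passes from the former to the latter.
-/
theorem lintegral_busyLength (φ : I) {e : Bool × ℝ → ℝ} (he : Measurable e) (N : ℕ) (z : ℝ) :
    ∫⁻ ω, busyLength N (z + e ((ω 0).1, (ω 0).2.1)) ω ∂Q.law φ =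
      ∫⁻ u, busyMean Q.lam (Q.premiumLaw φ) N (z + u) ∂Q.workLaw φ e := by
  have := Q.isProbabilityMeasure_workLaw φ measurable_premiumPart
  induction N generalizing e z with
  | zero =>
    simp only [busyLength, busyMean]
    rw [workLaw, lintegral_map (by fun_prop) (by fun_prop)]
    exact lintegral_infinitePi_eval_zero (Q.customerLaw φ)
      (f := fun c => ENNReal.ofReal (z + e (c.1, c.2.1))) (by fun_prop)
  | succ N ih =>
    have hm : Measurable fun ω : ℕ → Customer =>
        busyLength (N + 1) (z + e ((ω 0).1, (ω 0).2.1)) ω :=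
      (measurable_busyLength (N + 1)).comp
        ((((he.comp (by fun_prop : Measurable fun c : Customer => (c.1, c.2.1))).comp
          (measurable_pi_apply 0)).const_add z).prodMk measurable_id)
    have hG := measurable_lintegral_add (ν := Q.premiumLaw φ)
      (measurable_busyMean (ν := Q.premiumLaw φ) Q.lam_pos N)
    rw [law_eq, lintegral_infinitePi_seqCons _ hm]
    calc _ = ∫⁻ c, (fun u a => if a < z + u then ENNReal.ofReal a +
            ∫⁻ u', busyMean Q.lam (Q.premiumLaw φ) N (z + u - a + u') ∂Q.premiumLaw φ
            else ENNReal.ofReal (z + u)) (e (c.1, c.2.1)) c.gap ∂Q.customerLaw φ := by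
          refine lintegral_congr fun c => ?_
          have hshift : ∀ ω : ℕ → Customer, seqShift 1 (seqCons c ω) = ω := fun ω =>
            funext fun k => by simp only [seqShift, add_comm 1 k]; rfl
          simp only [busyLength, hshift]
          change ∫⁻ ω, (if c.gap < z + e (c.1, c.2.1) then ENNReal.ofReal c.gap +
            busyLength N (z + e (c.1, c.2.1) - c.gap + premiumPart ((ω 0).1, (ω 0).2.1)) ω else
            ENNReal.ofReal (z + e (c.1, c.2.1))) ∂Q.law φ = _
          split_ifs with h
          · rw [lintegral_add_left measurable_const, lintegral_const, measure_univ, mul_one,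
              ih measurable_premiumPart]
          · simp
      _ = _ := Q.lintegral_customerLaw φ he (F := fun u a => if a < z + u then ENNReal.ofReal a +
            ∫⁻ u', busyMean Q.lam (Q.premiumLaw φ) N (z + u - a + u') ∂Q.premiumLaw φ
            else ENNReal.ofReal (z + u)) (by
          refine Measurable.ite (measurableSet_lt measurable_snd (by fun_prop)) ?_ (by fun_prop)
          exact (by fun_prop : Measurable fun p : ℝ × ℝ => ENNReal.ofReal p.2).add
            (hG.comp (by fun_prop : Measurable fun p : ℝ × ℝ => z + p.1 - p.2)))


theorem measurable_busyLength_seqShift (n N : ℕ) :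
    Measurable fun ω => busyLength N ((workFound ω n).1 + (workFound ω n).2 + (ω n).req)
      (seqShift n ω) := by
  have hw := measurable_workFound n
  have hreq : Measurable fun ω : ℕ → Customer => (ω n).req :=
    measurable_req.comp (measurable_pi_apply n)
  exact (measurable_busyLength N).comp
    (((hw.fst.add hw.snd).add hreq).prodMk (measurable_seqShift n))

/-- The work found depends on customers before n only; the own requirement is the first term of the
independent future. -/
theorem lintegral_busyLength_seqShift (φ : I) (n N : ℕ) :
    ∫⁻ ω, busyLength N ((workFound ω n).1 + (workFound ω n).2 + (ω n).req) (seqShift n ω) ∂Q.law φ =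
      ∫⁻ ω, ∫⁻ u, busyMean Q.lam (Q.premiumLaw φ) N ((workFound ω n).1 + (workFound ω n).2 + u)
        ∂Q.service ∂Q.law φ := by
  have hreq : Measurable fun p : (ℝ × ℝ) × (ℕ → Customer) => (p.2 0).req :=
    measurable_req.comp ((measurable_pi_apply 0).comp measurable_snd)
  have hF : Measurable fun p : (ℝ × ℝ) × (ℕ → Customer) =>
      busyLength N (p.1.1 + p.1.2 + (p.2 0).req) p.2 :=
    (measurable_busyLength N).comp
      (((by fun_prop : Measurable fun p : (ℝ × ℝ) × (ℕ → Customer) => p.1.1 + p.1.2).add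
        hreq).prodMk measurable_snd)
  have h := lintegral_stateAfter_seqShift (Q.customerLaw φ) measurable_workStep
    (F := fun s ω' => busyLength N (s.1 + s.2 + (ω' 0).req) ω') hF n (0, 0)
  simp only [← workFound_eq_stateAfter, ← law_eq] at h
  refine h.trans (lintegral_congr fun ω => ?_)
  rw [← Q.workLaw_snd φ]
  exact Q.lintegral_busyLength φ measurable_snd N _

/-- Mean time in system of a customer who joins the ordinary class. -/
theorem lintegral_ordinarySojourn (φ : I) (n : ℕ) {κ r : ℝ≥0∞}
    (hν : ∀ᵐ u ∂Q.premiumLaw φ, 0 ≤ u)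
    (hr : posMoment 1 (Q.premiumLaw φ) = r * ENNReal.ofReal Q.lam⁻¹) (hκ : κ = 1 + κ * r)
    (hκt : κ ≠ ⊤) (hr1 : r < 1) (h2 : posMoment 2 (Q.premiumLaw φ) ≠ ⊤)
    (hs : posMoment 1 Q.service ≠ ⊤) (hW : posMoment 1 (lindleyLaw Q.lam Q.service n) ≠ ⊤) :
    ∫⁻ ω, ordinarySojourn ω n ∂Q.law φ =
      κ * (posMoment 1 (lindleyLaw Q.lam Q.service n) + posMoment 1 Q.service) := by
  have := Q.isProbabilityMeasure_workLaw φ measurable_premiumPart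
  have hbusy : ∀ N z, Measurable fun u => busyMean Q.lam (Q.premiumLaw φ) N (z + u) := fun N z =>
    (measurable_busyMean Q.lam_pos N).comp (measurable_const_add z)
  have hw := measurable_workFound n
  have hsum : Measurable fun ω => (workFound ω n).1 + (workFound ω n).2 := hw.fst.add hw.snd
  have hint : ∀ ω : ℕ → Customer,
      ∫⁻ u, κ * ENNReal.ofReal ((workFound ω n).1 + (workFound ω n).2 + u) ∂Q.service =
        κ * (ENNReal.ofReal ((workFound ω n).1 + (workFound ω n).2) + posMoment 1 Q.service) :=
    fun ω => by
      rw [lintegral_const_mul _ (by fun_prop), lintegral_ofReal_add Q.service_nonneg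
        (add_nonneg (workFound_nonneg ω n).1 (workFound_nonneg ω n).2)]
  have htot : ∫⁻ ω, κ * (ENNReal.ofReal ((workFound ω n).1 + (workFound ω n).2)
        + posMoment 1 Q.service) ∂Q.law φ =
      κ * (posMoment 1 (lindleyLaw Q.lam Q.service n) + posMoment 1 Q.service) := by
    rw [lintegral_const_mul _ (by fun_prop), lintegral_add_left (by fun_prop),
      Q.lintegral_totalWork φ n]
    simp
  have hbound : ∀ (N : ℕ) (ω : ℕ → Customer), ∀ᵐ u ∂Q.service,
      busyMean Q.lam (Q.premiumLaw φ) N ((workFound ω n).1 + (workFound ω n).2 + u) ≤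
        κ * ENNReal.ofReal ((workFound ω n).1 + (workFound ω n).2 + u) := fun N ω =>
    Q.service_nonneg.mono fun u hu => busyMean_le Q.lam_pos hν hr hκ N
      (add_nonneg (add_nonneg (workFound_nonneg ω n).1 (workFound_nonneg ω n).2) hu)
  have hlim1 : Tendsto (fun N => ∫⁻ ω, busyLength N
      ((workFound ω n).1 + (workFound ω n).2 + (ω n).req) (seqShift n ω) ∂Q.law φ) atTop
      (𝓝 (∫⁻ ω, ordinarySojourn ω n ∂Q.law φ)) := by
    refine lintegral_tendsto_of_tendsto_of_monotone
      (fun N => (measurable_busyLength_seqShift n N).aemeasurable)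
      ((Q.ae_law_isRegular φ).mono fun ω h => monotone_busyLength (h.seqShift n) _)
      ((Q.ae_law_isRegular φ).mono fun ω h => ?_)
    rw [ordinarySojourn_eq_iSup h n]
    exact tendsto_atTop_iSup (monotone_busyLength (h.seqShift n) _)
  refine tendsto_nhds_unique hlim1 ?_
  simp_rw [Q.lintegral_busyLength_seqShift φ n]
  rw [← htot]
  -- Dominated convergence twice, over the work found and over the own requirement, with the bound κ
  -- times the initial work from `busyMean_le`.
  refine tendsto_lintegral_of_dominated_convergence
    (fun ω => κ * (ENNReal.ofReal ((workFound ω n).1 + (workFound ω n).2) + posMoment 1 Q.service))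
    (fun N => ?_) (fun N => ae_of_all _ fun ω => ?_) (by rw [htot]; finiteness)
    (ae_of_all _ fun ω => ?_)
  · exact (measurable_lintegral_add (ν := Q.service)
      (measurable_busyMean (ν := Q.premiumLaw φ) Q.lam_pos N)).comp hsum
  · exact (lintegral_mono_ae (hbound N ω)).trans_eq (hint ω)
  · rw [← hint ω]
    refine tendsto_lintegral_of_dominated_convergence _ (fun N => hbusy N _)
      (fun N => hbound N ω) (by rw [hint]; finiteness) (Q.service_nonneg.mono fun u hu => ?_)
    exact tendsto_busyMean Q.lam_pos hν hr hκ hκt hr1 h2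
      (add_nonneg (add_nonneg (workFound_nonneg ω n).1 (workFound_nonneg ω n).2) hu)

theorem meanOrdinaryWait_eq (φ : I) (n : ℕ) (hs : posMoment 1 Q.service ≠ ⊤) :
    Q.meanOrdinaryWait φ n = ∫⁻ ω, ordinarySojourn ω n ∂Q.law φ - posMoment 1 Q.service := by
  have hm : Measurable fun ω : ℕ → Customer => ENNReal.ofReal (ω n).req :=
    (measurable_req.comp (measurable_pi_apply n)).ennreal_ofReal
  have hreq : ∫⁻ ω, ENNReal.ofReal (ω n).req ∂Q.law φ = posMoment 1 Q.service := by
    have h := (measurePreserving_eval_infinitePi (fun _ : ℕ => Q.customerLaw φ) n).lintegral_comp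
      measurable_req.ennreal_ofReal
    simp only [posMoment, pow_one]
    rw [← Q.workLaw_snd φ, workLaw, lintegral_map (by fun_prop) (by fun_prop)]
    exact h
  unfold meanOrdinaryWait ordinaryWait
  rw [lintegral_sub hm (by rwa [hreq]) ((Q.ae_law_isRegular φ).mono fun ω h => ?_), hreq]
  rw [ordinarySojourn_eq_iSup h n]
  -- The term N = 0 already shows that the sojourn is at least the requirement, so truncated
  -- subtraction commutes with the integral.
  refine le_trans (ENNReal.ofReal_le_ofReal ?_) (le_iSup
    (fun N => busyLength N ((workFound ω n).1 + (workFound ω n).2 + (ω n).req) (seqShift n ω)) 0)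
  linarith [(workFound_nonneg ω n).1, (workFound_nonneg ω n).2]

/-! ### Moments of the primitives -/

theorem integrable_service : Integrable (fun s : ℝ => s) Q.service :=
  ((memLp_two_iff_integrable_sq (by fun_prop)).2 Q.service_sq_integrable).integrable (by norm_num)

theorem posMoment_one_service : posMoment 1 Q.service = ENNReal.ofReal (∫ s, s ∂Q.service) := by
  rw [ofReal_integral_eq_lintegral_ofReal Q.integrable_service Q.service_nonneg]
  simp [posMoment]

theorem posMoment_two_service : posMoment 2 Q.service = ENNReal.ofReal (∫ s, s ^ 2 ∂Q.service) := by
  rw [ofReal_integral_eq_lintegral_ofReal Q.service_sq_integrable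
    (ae_of_all _ fun s => sq_nonneg s)]
  exact lintegral_congr_ae (Q.service_nonneg.mono fun s hs => (ENNReal.ofReal_pow hs 2).symm)

theorem posMoment_premiumLaw (φ : I) {k : ℕ} (hk : k ≠ 0) :
    posMoment k (Q.premiumLaw φ) = ENNReal.ofReal φ * posMoment k Q.service := by
  rw [posMoment, Q.lintegral_workLaw φ measurable_premiumPart (by fun_prop),
    lintegral_bernoulliMeasure]
  simp [premiumPart, posMoment, hk]

theorem ae_premiumLaw_nonneg (φ : I) : ∀ᵐ u ∂Q.premiumLaw φ, 0 ≤ u := by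
  have hm : Measurable fun c : Customer => premiumPart (c.1, c.2.1) := measurable_premiumReq
  refine (ae_map_iff hm.aemeasurable measurableSet_Ici).2 ?_
  exact (Q.ae_customerLaw_regular φ).mono fun c hc => Customer.premiumReq_nonneg hc.1

/-! ### Steady-state means -/

/-- Mean service requirement. -/
noncomputable def serviceMean : ℝ := ∫ s, s ∂Q.service

/-- Second moment of the service requirement. -/
noncomputable def serviceSq : ℝ := ∫ s, s ^ 2 ∂Q.service

theorem serviceMean_pos : 0 < Q.serviceMean := Q.service_mean_pos

theorem serviceSq_nonneg : 0 ≤ Q.serviceSq := integral_nonneg fun s => sq_nonneg s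

theorem lam_mul_serviceMean_lt_one : Q.lam * Q.serviceMean < 1 := Q.stable

theorem serviceMean_lt_inv_lam : Q.serviceMean < Q.lam⁻¹ := by
  rw [lt_inv_comm₀ Q.serviceMean_pos Q.lam_pos, lt_inv_comm₀ Q.lam_pos Q.serviceMean_pos,
    ← one_div, lt_div_iff₀ Q.lam_pos, mul_comm]
  exact Q.lam_mul_serviceMean_lt_one

theorem coe_mul_serviceMean_le (φ : I) : (φ : ℝ) * Q.serviceMean ≤ Q.serviceMean :=
  mul_le_of_le_one_left Q.serviceMean_pos.le φ.2.2

/-- Pollaczek–Khinchine formula for requirements with real moments. -/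
theorem tendsto_posMoment_one_lindleyLaw_ofReal {ν : Measure ℝ} [IsProbabilityMeasure ν]
    (hν : ∀ᵐ u ∂ν, 0 ≤ u) {a b : ℝ} (ha : 0 ≤ a) (hal : a < Q.lam⁻¹)
    (h1 : posMoment 1 ν = ENNReal.ofReal a) (h2 : posMoment 2 ν = ENNReal.ofReal b) :
    Tendsto (fun n => posMoment 1 (lindleyLaw Q.lam ν n)) atTop
      (𝓝 (ENNReal.ofReal (b / (2 * (Q.lam⁻¹ - a))))) := by
  have h := tendsto_posMoment_one_lindleyLaw Q.lam_pos hν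
    (by rw [h1]; exact (ENNReal.ofReal_lt_ofReal_iff (inv_pos.2 Q.lam_pos)).2 hal)
    (by rw [h2]; exact ENNReal.ofReal_ne_top)
  rw [h1, h2, ← ENNReal.ofReal_sub _ ha, ← ENNReal.ofReal_ofNat 2,
    ← ENNReal.ofReal_mul zero_le_two, ← ENNReal.ofReal_div_of_pos (by linarith)] at h
  exact h

theorem tendsto_meanPremiumWait (φ : I) :
    Tendsto (Q.meanPremiumWait φ) atTop
      (𝓝 (ENNReal.ofReal (φ * Q.serviceSq / (2 * (Q.lam⁻¹ - φ * Q.serviceMean))))) := by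
  have := Q.isProbabilityMeasure_workLaw φ measurable_premiumPart
  have h := Q.tendsto_posMoment_one_lindleyLaw_ofReal (Q.ae_premiumLaw_nonneg φ)
    (a := φ * Q.serviceMean) (b := φ * Q.serviceSq)
    (mul_nonneg φ.2.1 Q.serviceMean_pos.le)
    ((Q.coe_mul_serviceMean_le φ).trans_lt Q.serviceMean_lt_inv_lam)
    (by rw [Q.posMoment_premiumLaw φ one_ne_zero, Q.posMoment_one_service,
      ENNReal.ofReal_mul φ.2.1]; rfl)
    (by rw [Q.posMoment_premiumLaw φ two_ne_zero, Q.posMoment_two_service,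
      ENNReal.ofReal_mul φ.2.1]; rfl)
  exact h.congr fun n => (Q.meanPremiumWait_eq φ n).symm

theorem tendsto_meanOrdinaryWait (φ : I) :
    Tendsto (Q.meanOrdinaryWait φ) atTop
      (𝓝 (ENNReal.ofReal ((1 - Q.lam * (φ * Q.serviceMean))⁻¹ *
        (Q.serviceSq / (2 * (Q.lam⁻¹ - Q.serviceMean)) + Q.serviceMean) - Q.serviceMean))) := by
  have hs1 : posMoment 1 Q.service = ENNReal.ofReal Q.serviceMean := Q.posMoment_one_service
  have hs2 : posMoment 2 Q.service = ENNReal.ofReal Q.serviceSq := Q.posMoment_two_service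
  have hlim := Q.tendsto_posMoment_one_lindleyLaw_ofReal Q.service_nonneg Q.serviceMean_pos.le
    Q.serviceMean_lt_inv_lam hs1 hs2
  have hfin : ∀ n, posMoment 1 (lindleyLaw Q.lam Q.service n) ≠ ⊤ := fun n =>
    ne_top_of_le_ne_top ENNReal.ofReal_ne_top
      ((monotone_posMoment_lindleyLaw Q.lam_pos 1).ge_of_tendsto hlim n)
  have hx0 : 0 ≤ Q.lam * (φ * Q.serviceMean) :=
    mul_nonneg Q.lam_pos.le (mul_nonneg φ.2.1 Q.serviceMean_pos.le)
  have hx1 : Q.lam * (φ * Q.serviceMean) < 1 :=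
    (mul_le_mul_of_nonneg_left (Q.coe_mul_serviceMean_le φ) Q.lam_pos.le).trans_lt
      Q.lam_mul_serviceMean_lt_one
  -- The premium load φρ, in the role of r; accordingly κ = 1/(1 - φρ).
  set x := Q.lam * (φ * Q.serviceMean) with hx
  have hy : 0 < (1 - x)⁻¹ := inv_pos.2 (by linarith)
  have hr : posMoment 1 (Q.premiumLaw φ) = ENNReal.ofReal x * ENNReal.ofReal Q.lam⁻¹ := by
    rw [Q.posMoment_premiumLaw φ one_ne_zero, hs1, ← ENNReal.ofReal_mul φ.2.1,
      ← ENNReal.ofReal_mul hx0, hx]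
    congr 1
    field_simp [Q.lam_pos.ne']
  have hκ : ENNReal.ofReal (1 - x)⁻¹ = 1 + ENNReal.ofReal (1 - x)⁻¹ * ENNReal.ofReal x := by
    rw [← ENNReal.ofReal_mul hy.le, ← ENNReal.ofReal_one,
      ← ENNReal.ofReal_add zero_le_one (mul_nonneg hy.le hx0)]
    congr 1
    have : 1 - x ≠ 0 := by linarith
    field_simp
    ring
  have h2 : posMoment 2 (Q.premiumLaw φ) ≠ ⊤ := by
    rw [Q.posMoment_premiumLaw φ two_ne_zero, hs2]; finiteness
  have hs1t : posMoment 1 Q.service ≠ ⊤ := by rw [hs1]; exact ENNReal.ofReal_ne_top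
  have hEW : 0 ≤ Q.serviceSq / (2 * (Q.lam⁻¹ - Q.serviceMean)) :=
    div_nonneg Q.serviceSq_nonneg (by linarith [Q.serviceMean_lt_inv_lam])
  have hmean : ∀ n, Q.meanOrdinaryWait φ n = ENNReal.ofReal (1 - x)⁻¹ *
      (posMoment 1 (lindleyLaw Q.lam Q.service n) + ENNReal.ofReal Q.serviceMean)
        - ENNReal.ofReal Q.serviceMean := fun n => by
    rw [Q.meanOrdinaryWait_eq φ n hs1t, Q.lintegral_ordinarySojourn φ n (Q.ae_premiumLaw_nonneg φ)
      hr hκ ENNReal.ofReal_ne_top (by simpa using hx1) h2 hs1t (hfin n), hs1]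
  have hfinal := ENNReal.Tendsto.sub (ENNReal.Tendsto.const_mul
    (hlim.add_const (ENNReal.ofReal Q.serviceMean))
      (Or.inr (ENNReal.ofReal_ne_top (r := (1 - x)⁻¹))))
    (tendsto_const_nhds (x := ENNReal.ofReal Q.serviceMean)) (Or.inr ENNReal.ofReal_ne_top)
  rw [← ENNReal.ofReal_add hEW Q.serviceMean_pos.le, ← ENNReal.ofReal_mul hy.le,
    ← ENNReal.ofReal_sub _ Q.serviceMean_pos.le] at hfinal
  exact hfinal.congr fun n => (hmean n).symm

theorem Wp_eq (φ : I) :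
    Q.Wp φ = ENNReal.ofReal (φ * Q.serviceSq / (2 * (Q.lam⁻¹ - φ * Q.serviceMean))) :=
  (Q.tendsto_meanPremiumWait φ).limsup_eq

theorem Wo_eq (φ : I) :
    Q.Wo φ = ENNReal.ofReal ((1 - Q.lam * (φ * Q.serviceMean))⁻¹ *
      (Q.serviceSq / (2 * (Q.lam⁻¹ - Q.serviceMean)) + Q.serviceMean) - Q.serviceMean) :=
  (Q.tendsto_meanOrdinaryWait φ).limsup_eq

theorem rho_eq : Q.rho = Q.lam * Q.serviceMean := by
  simp [rho, mu, serviceMean]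

theorem K_eq : Q.K = Q.serviceSq / Q.serviceMean ^ 2 := by
  simp [K, mu, serviceMean, serviceSq, div_eq_inv_mul]

theorem rho_pos : 0 < Q.rho := Q.rho_eq ▸ mul_pos Q.lam_pos Q.serviceMean_pos

theorem rho_lt_one : Q.rho < 1 := Q.rho_eq ▸ Q.lam_mul_serviceMean_lt_one

theorem one_sub_mul_rho_pos (φ : I) : 0 < 1 - (φ : ℝ) * Q.rho := by
  nlinarith [Q.rho_pos, Q.rho_lt_one, φ.2.1, φ.2.2]

theorem mu_pos : 0 < Q.mu := inv_pos.2 Q.service_mean_pos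

theorem indifferenceCost_eq (φ : I) : Q.indifferenceCost φ =
    (Q.K * Q.rho + (2 - Q.K) * (φ : ℝ) * Q.rho * (1 - Q.rho)) /
      (2 * Q.mu * (1 - Q.rho) * (1 - (φ : ℝ) * Q.rho)) := by
  have hm := Q.serviceMean_pos
  have hl := Q.lam_pos
  have hq := Q.serviceSq_nonneg
  have h1 : 0 < 1 - Q.lam * Q.serviceMean := sub_pos.2 Q.lam_mul_serviceMean_lt_one
  have h2 : 0 < 1 - (φ : ℝ) * (Q.lam * Q.serviceMean) := Q.rho_eq ▸ Q.one_sub_mul_rho_pos φ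
  have hφ := φ.2.1
  have e1 : Q.lam⁻¹ - φ * Q.serviceMean = (1 - (φ : ℝ) * (Q.lam * Q.serviceMean)) / Q.lam := by
    field_simp
  have e2 : Q.lam⁻¹ - Q.serviceMean = (1 - Q.lam * Q.serviceMean) / Q.lam := by
    field_simp
  have e3 : 1 - Q.lam * (φ * Q.serviceMean) = 1 - (φ : ℝ) * (Q.lam * Q.serviceMean) := by ring
  have hmu : Q.mu = Q.serviceMean⁻¹ := rfl
  have hx : 0 ≤ (φ : ℝ) * (Q.lam * Q.serviceMean) := by positivity
  rw [indifferenceCost, Q.Wo_eq, Q.Wp_eq, e1, e2, e3, Q.K_eq, Q.rho_eq, hmu,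
    ENNReal.toReal_ofReal, ENNReal.toReal_ofReal]
  · have h4 : 1 - Q.lam * Q.serviceMean * φ ≠ 0 := by rw [mul_comm]; exact h2.ne'
    rw [mul_comm (φ : ℝ) (Q.lam * Q.serviceMean)]
    field_simp
    ring
  · positivity
  -- The real expression for E[W_o] must be nonnegative for `ENNReal.ofReal` not to truncate it; the
  -- factor 1/(1 - φρ) ≥ 1 ensures this.
  · have hge : 1 ≤ (1 - (φ : ℝ) * (Q.lam * Q.serviceMean))⁻¹ :=
      (one_le_inv₀ h2).2 (by linarith)
    have hE : 0 ≤ Q.serviceSq / (2 * ((1 - Q.lam * Q.serviceMean) / Q.lam)) := by positivity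
    nlinarith

/-! ### Coefficient of variation of the service requirement -/

theorem variance_service :
    Var[fun s : ℝ => s; Q.service] = Q.serviceSq - Q.serviceMean ^ 2 :=
  variance_eq_sub ((memLp_two_iff_integrable_sq (by fun_prop)).2 Q.service_sq_integrable)

theorem one_le_K : 1 ≤ Q.K := by
  rw [Q.K_eq, one_le_div (pow_pos Q.serviceMean_pos 2)]
  linarith [Q.variance_service ▸ variance_nonneg (fun s : ℝ => s) Q.service]

/-- K - 1 is the squared coefficient of variation. -/
theorem two_lt_K_iff : 2 < Q.K ↔ 1 < √(Var[fun s : ℝ => s; Q.service]) / ∫ s, s ∂Q.service := by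
  change _ ↔ 1 < _ / Q.serviceMean
  rw [one_lt_div Q.serviceMean_pos, Real.lt_sqrt Q.serviceMean_pos.le, Q.variance_service, Q.K_eq,
    lt_div_iff₀ (pow_pos Q.serviceMean_pos 2)]
  constructor <;> intro h <;> linarith

/-! ### The game -/

theorem cost_sub_cost (C : ℝ) (ψ χ φ : I) :
    Q.cost C ψ φ - Q.cost C χ φ = ((ψ : ℝ) - χ) * (C - Q.indifferenceCost φ) := by
  unfold cost indifferenceCost; ring

/-- The difference quotients of the indifference cost have a constant sign. -/
theorem indifferenceCost_sub (φ χ : I) :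
    Q.indifferenceCost φ - Q.indifferenceCost χ = ((φ : ℝ) - χ) *
      ((Q.rho * (2 - Q.K + Q.rho * (2 * Q.K - 2))) /
        (2 * Q.mu * (1 - Q.rho) * (1 - (φ : ℝ) * Q.rho) * (1 - (χ : ℝ) * Q.rho))) := by
  have h1 : 1 - Q.rho * φ ≠ 0 := by rw [mul_comm]; exact (Q.one_sub_mul_rho_pos φ).ne'
  have h2 : 1 - Q.rho * χ ≠ 0 := by rw [mul_comm]; exact (Q.one_sub_mul_rho_pos χ).ne'
  have h3 := (sub_pos.2 Q.rho_lt_one).ne'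
  have h4 := Q.mu_pos.ne'
  rw [indifferenceCost_eq, indifferenceCost_eq, mul_comm (φ : ℝ) Q.rho, mul_comm (χ : ℝ) Q.rho]
  field_simp
  ring

/-- Since K ≥ 1, the term ρ(2K - 2) is nonnegative, so a negative sum already forces K > 2. -/
theorem condition_iff : (2 < Q.K ∧ Q.rho < (Q.K - 2) / (2 * Q.K - 2)) ↔
    2 - Q.K + Q.rho * (2 * Q.K - 2) < 0 := by
  have hρ := Q.rho_pos
  have hK := Q.one_le_K
  constructor
  · rintro ⟨h1, h2⟩
    rw [lt_div_iff₀ (by linarith)] at h2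
    linarith
  · intro h
    have h1 : 2 < Q.K := by nlinarith
    exact ⟨h1, by rw [lt_div_iff₀ (by linarith)]; linarith⟩

theorem slope_denominator_pos (φ χ : I) :
    0 < 2 * Q.mu * (1 - Q.rho) * (1 - (φ : ℝ) * Q.rho) * (1 - (χ : ℝ) * Q.rho) := by
  have h1 := Q.one_sub_mul_rho_pos φ
  have h2 := Q.one_sub_mul_rho_pos χ
  have h3 := sub_pos.2 Q.rho_lt_one
  have h4 := Q.mu_pos
  positivity

theorem strictAnti_indifferenceCost (h : 2 - Q.K + Q.rho * (2 * Q.K - 2) < 0) :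
    StrictAnti Q.indifferenceCost := fun φ χ hlt => by
  have hlt' : (φ : ℝ) < χ := hlt
  have := Q.indifferenceCost_sub χ φ
  have hneg := div_neg_of_neg_of_pos (mul_neg_of_pos_of_neg Q.rho_pos h)
    (Q.slope_denominator_pos χ φ)
  nlinarith

/-- The sign of the slope is constant, so comparing the two endpoints determines it. -/
theorem condition_of_indifferenceCost_lt
    (h : Q.indifferenceCost 1 < Q.indifferenceCost 0) :
    2 - Q.K + Q.rho * (2 * Q.K - 2) < 0 := by
  by_contra hn
  have := Q.indifferenceCost_sub 1 0
  have hnn := div_nonneg (mul_nonneg Q.rho_pos.le (not_lt.1 hn)) (Q.slope_denominator_pos 1 0).le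
  simp only [Set.Icc.coe_one, Set.Icc.coe_zero, sub_zero, one_mul] at this hnn
  linarith

theorem continuous_indifferenceCost : Continuous Q.indifferenceCost := by
  simp_rw [funext Q.indifferenceCost_eq]
  refine Continuous.div (by fun_prop) (by fun_prop) fun φ => ?_
  have h1 := Q.one_sub_mul_rho_pos φ
  have h3 := sub_pos.2 Q.rho_lt_one
  have h4 := Q.mu_pos
  positivity

theorem isBestResponse_iff (C : ℝ) (ψ φ : I) :
    Q.IsBestResponse C ψ φ ↔ ∀ χ : I, ((ψ : ℝ) - χ) * (C - Q.indifferenceCost φ) ≤ 0 :=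
  forall_congr' fun χ => by rw [← Q.cost_sub_cost, sub_nonpos]

theorem isEquilibrium_of_eq {C : ℝ} {φ : I} (h : C = Q.indifferenceCost φ) :
    Q.IsEquilibrium C φ :=
  (Q.isBestResponse_iff C φ φ).2 fun χ => by rw [h, sub_self, mul_zero]

theorem isEquilibrium_one_iff (C : ℝ) : Q.IsEquilibrium C 1 ↔ C ≤ Q.indifferenceCost 1 := by
  rw [IsEquilibrium, isBestResponse_iff]
  constructor
  · intro h
    simpa using h 0
  · intro h χ
    exact mul_nonpos_of_nonneg_of_nonpos (sub_nonneg.2 χ.2.2) (sub_nonpos.2 h)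

theorem isEquilibrium_zero_iff (C : ℝ) : Q.IsEquilibrium C 0 ↔ Q.indifferenceCost 0 ≤ C := by
  rw [IsEquilibrium, isBestResponse_iff]
  constructor
  · intro h
    simpa using h 1
  · intro h χ
    exact mul_nonpos_of_nonpos_of_nonneg (sub_nonpos.2 χ.2.1) (sub_nonneg.2 h)

/-- At an interior equilibrium both classes cost the same. -/
theorem IsEquilibrium.eq_indifferenceCost {Q : MG1Queue} {C : ℝ} {φ : I}
    (h : Q.IsEquilibrium C φ) (h0 : 0 < (φ : ℝ)) (h1 : (φ : ℝ) < 1) :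
    C = Q.indifferenceCost φ := by
  rw [IsEquilibrium, isBestResponse_iff] at h
  have ha := h 0
  have hb := h 1
  simp only [Set.Icc.coe_one, Set.Icc.coe_zero, sub_zero] at ha hb
  nlinarith

theorem exists_isUniqueMixedEquilibrium_iff (C : ℝ) :
    (∃ φ : I, Q.IsUniqueMixedEquilibrium C φ) ↔
      (2 < Q.K ∧ Q.rho < (Q.K - 2) / (2 * Q.K - 2)) ∧
        Q.indifferenceCost 1 < C ∧ C < Q.indifferenceCost 0 := by
  rw [condition_iff]
  constructor
  · rintro ⟨φ, ⟨h0, h1⟩, -, huniq⟩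
    have hlt1 : Q.indifferenceCost 1 < C := by
      by_contra hn
      have := huniq 1 ((Q.isEquilibrium_one_iff C).2 (not_lt.1 hn))
      simp [← this] at h1
    have hlt0 : C < Q.indifferenceCost 0 := by
      by_contra hn
      have := huniq 0 ((Q.isEquilibrium_zero_iff C).2 (not_lt.1 hn))
      simp [← this] at h0
    exact ⟨Q.condition_of_indifferenceCost_lt (hlt1.trans hlt0), hlt1, hlt0⟩
  · rintro ⟨hcond, hlt1, hlt0⟩
    -- Continuity yields a solution of C(φ) = C, which is interior because the fee differs from both
    -- endpoint values. The strict bounds exclude pure equilibria, and injectivity excludes a second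
    -- mixed one.
    have hanti := Q.strictAnti_indifferenceCost hcond
    obtain ⟨φ, -, hφ⟩ := intermediate_value_Icc' (zero_le_one' I)
      Q.continuous_indifferenceCost.continuousOn ⟨hlt1.le, hlt0.le⟩
    have h0 : φ ≠ 0 := by rintro rfl; exact hlt0.ne' hφ
    have h1 : φ ≠ 1 := by rintro rfl; exact hlt1.ne hφ
    refine ⟨φ, ⟨unitInterval.pos_iff_ne_zero.2 h0, unitInterval.lt_one_iff_ne_one.2 h1⟩,
      Q.isEquilibrium_of_eq hφ.symm, fun ψ hψ => ?_⟩
    have hψ0 : ψ ≠ 0 := by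
      rintro rfl; exact hlt0.not_ge ((Q.isEquilibrium_zero_iff C).1 hψ)
    have hψ1 : ψ ≠ 1 := by
      rintro rfl; exact hlt1.not_ge ((Q.isEquilibrium_one_iff C).1 hψ)
    have hC := hψ.eq_indifferenceCost (unitInterval.pos_iff_ne_zero.2 hψ0)
      (unitInterval.lt_one_iff_ne_one.2 hψ1)
    exact hanti.injective (hC.symm.trans hφ.symm)

theorem IsUniqueMixedEquilibrium.isESS {Q : MG1Queue} {C : ℝ} {φ : I}
    (h : Q.IsUniqueMixedEquilibrium C φ) : Q.IsESS C φ := by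
  have hanti := Q.strictAnti_indifferenceCost
    (Q.condition_iff.1 ((Q.exists_isUniqueMixedEquilibrium_iff C).1 ⟨φ, h⟩).1)
  obtain ⟨⟨h0, h1⟩, heq, huniq⟩ := h
  have hC := heq.eq_indifferenceCost h0 h1
  -- Any ε ≤ 1 works, hence ε₀ = 1. The mixture lies strictly on the side of ψ, so C(φ) - C(mixture)
  -- and φ - ψ have opposite signs. The last clause is vacuous by uniqueness.
  refine ⟨heq, fun ψ hψ => ⟨1, one_pos, fun ε hε _ => ?_⟩, fun ψ hne hψ => absurd (huniq ψ hψ) hne⟩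
  rw [← sub_neg, Q.cost_sub_cost, hC]
  have hcoe : ((invaded ε φ ψ : I) : ℝ) = φ + ε * ((ψ : ℝ) - φ) := by
    change (1 - (ε : ℝ)) * φ + ε * ψ = _
    ring
  rcases lt_or_gt_of_ne hψ with hlt | hgt
  · have hlt' : (ψ : ℝ) < φ := hlt
    have : Q.indifferenceCost φ < Q.indifferenceCost (invaded ε φ ψ) := hanti (by
      rw [← Subtype.coe_lt_coe, hcoe]
      nlinarith)
    exact mul_neg_of_pos_of_neg (by linarith) (by linarith)
  · have hgt' : (φ : ℝ) < ψ := hgt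
    have : Q.indifferenceCost (invaded ε φ ψ) < Q.indifferenceCost φ := hanti (by
      rw [← Subtype.coe_lt_coe, hcoe]
      nlinarith)
    exact mul_neg_of_neg_of_pos (by linarith) (by linarith)

end MG1Queue

theorem mainTheorem3 (Q : MG1Queue) :
    -- the steady-state expected waiting times are genuine finite limits, with this difference
    (∀ φ : I,
      Tendsto (Q.meanPremiumWait φ) atTop (𝓝 (Q.Wp φ)) ∧ Q.Wp φ ≠ ⊤ ∧
      Tendsto (Q.meanOrdinaryWait φ) atTop (𝓝 (Q.Wo φ)) ∧ Q.Wo φ ≠ ⊤ ∧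
      Q.indifferenceCost φ =
        (Q.K * Q.rho + (2 - Q.K) * (φ : ℝ) * Q.rho * (1 - Q.rho)) /
          (2 * Q.mu * (1 - Q.rho) * (1 - (φ : ℝ) * Q.rho))) ∧
    -- some fee yields a unique mixed equilibrium iff `K > 2` and the load is low
    ((∃ C : ℝ, ∃ φ : I, Q.IsUniqueMixedEquilibrium C φ) ↔
      2 < Q.K ∧ Q.rho < (Q.K - 2) / (2 * Q.K - 2)) ∧
    -- and then exactly the fees strictly between `C(1)` and `C(0)` do
    (∀ C : ℝ, (∃ φ : I, Q.IsUniqueMixedEquilibrium C φ) ↔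
      (2 < Q.K ∧ Q.rho < (Q.K - 2) / (2 * Q.K - 2)) ∧
        Q.indifferenceCost 1 < C ∧ C < Q.indifferenceCost 0) ∧
    -- `K > 2` means that the coefficient of variation of the service exceeds one
    (2 < Q.K ↔ 1 < √(Var[fun s : ℝ => s; Q.service]) / ∫ s, s ∂Q.service) ∧
    -- stability
    (∀ (C : ℝ) (φ : I), Q.IsUniqueMixedEquilibrium C φ → Q.IsESS C φ) := by
  refine ⟨fun φ => ⟨?_, ?_, ?_, ?_, Q.indifferenceCost_eq φ⟩, ⟨?_, fun h => ?_⟩,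
    Q.exists_isUniqueMixedEquilibrium_iff, Q.two_lt_K_iff, fun _ _ h => h.isESS⟩
  · rw [Q.Wp_eq]; exact Q.tendsto_meanPremiumWait φ
  · rw [Q.Wp_eq]; exact ENNReal.ofReal_ne_top
  · rw [Q.Wo_eq]; exact Q.tendsto_meanOrdinaryWait φ
  · rw [Q.Wo_eq]; exact ENNReal.ofReal_ne_top
  · rintro ⟨C, hC⟩
    exact ((Q.exists_isUniqueMixedEquilibrium_iff C).1 hC).1
  · obtain ⟨C, hC1, hC0⟩ := exists_between
      (Q.strictAnti_indifferenceCost (Q.condition_iff.1 h) zero_lt_one)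
    exact ⟨C, (Q.exists_isUniqueMixedEquilibrium_iff C).2 ⟨h, hC1, hC0⟩⟩
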